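/- \textbf{Model.} Fix $n\ge 0$, $K\ge 1$. For each sample size $T$ let $0=\tau_0\le\tau_1\le\dots\le\tau_n\le\tau_{n+1}=T$ be deterministic candidate break dates (depending on $T$), with $\tau_i-\tau_{i-1}\to\infty$ as $T\to\infty$ for every $i=1,\dots,n+1$. Let $$y_t=\mathbf x_t'\boldsymbol\beta_i+\epsilon_t\quad\text{for } \tau_{i-1}<t\le\tau_i,\quad i=1,\dots,n+1,$$ with $\mathbf x_t=(1,x_{t,2},\dots,x_{t,K})'$ and fixed vectors $\boldsymbol\beta_i\in\mathbb R^K$. Some of the coefficient changes $\Delta\beta_{jk}=\beta_{jk}-\beta_{j-1,k}$, $2\le j\le n+1$, $1\le k\le K$, may be zero, even for all $k$ at once; so the candidate dates may be the true break dates or any larger set. Let $A=\{(j,k):\Delta\beta_{jk}\ne0\}$ be the true set of active parameter changes. Let $\tilde{\mathbf X}_{0}$ be the $T\times K$ matrix with rows $\mathbf x_t'$, and for a set $B$ of pairs $(j,k)$ let $\tilde{\mathbf X}^{B}$ be the matrix with the columns $(x_{t,k}\mathbf 1\{t>\tau_{j-1}\})_{t=1,\dots,T}$, $(j,k)\in B$.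 Let $\mathbf X=(\tilde{\mathbf X}_0,\tilde{\mathbf X}^{B})$ with $B$ the set of all pairs. \textbf{Assumptions.} (a) There are constants $r_0,R_0>0$ such that, with probability tending to one, all eigenvalues of $T^{-1}\mathbf X'\mathbf X$ lie in $[r_0,R_0]$. (b) Within each regime $(\tau_{i-1},\tau_i]$ the process $(\epsilon_t,\mathbf x_t)$ is a stretch of a stationary ergodic process whose law does not depend on $T$. (c) $\mathbb E(\epsilon_t\mid\mathbf x_t)=0$ and $\mathbb E(\epsilon_t^2)=\sigma^2$ with $\sigma>0$ constant, and $(\mathbf x_t\epsilon_t)_{1\le t\le T}$ is a martingale difference sequence with finite second moments. \textbf{Criterion.} For $g>0$ put $$f_T(B)=\Big(\frac{g}{1+g}\Big)^{|B|/2}\Big[\frac{g}{1+g}\,s_{\tilde{\mathbf X}_0}+\frac1{1+g}\,s_{\tilde{\mathbf X}_0,\tilde{\mathbf X}^{B}}\Big]^{-\frac{T-K}{2}},$$ where $s_{\mathbf Z}$ is the residual sum of squares of the ordinary least squares regression of $\mathbf y=(y_1,\dots,y_T)'$ on $\mathbf Z$. Let $g=1/w(T)$, where $w$ is a real function, differentiable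 for all large arguments, such that, as $T\to\infty$, (i) $w(T)\to\infty$, (ii) $w'(T)/w(T)\to0$, (iii) $T/w(T)$ converges to a limit in $[0,\infty)$. \textbf{Claim.} For every set $B\ne A$ of pairs $(j,k)$, the Bayes factor $f_T(B)/f_T(A)$ tends to $0$ in probability as $T\to\infty$. Consequently, with probability tending to one, $f_T(B)<f_T(A)$ for all $B\ne A$ simultaneously: the criterion is asymptotically maximized, uniquely, at the true set $A$. -/

import Mathlib

open MeasureTheory Filter Topology
open scoped Matrix

noncomputable section

namespace BreakRegression

/-!
There are `n` candidate break dates, hence `n + 1` regimes, and `K` explanatory variables.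
For the sample size `T` the dates are `1, …, T`. The array `τ T : Fin (n + 2) → ℕ` lists
`0 = τ₀ ≤ τ₁ ≤ ⋯ ≤ τₙ ≤ τₙ₊₁ = T`; the regime `i : Fin (n + 1)` consists of the dates `t` with
`τ T i.castSucc < t ≤ τ T i.succ`, and the candidate break `j : Fin n` takes place at
`τ T j.succ.castSucc`. A candidate break may be spurious (no coefficient changes there).
Row `r : Fin T` of a data matrix belongs to the date `r + 1`.
-/

/-- Candidate break dates for every sample size, all regimes having lengths that tend to
infinity. -/
structure IsBreakDates {n : ℕ} (τ : ℕ → Fin (n + 2) → ℕ) : Prop where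
  mono : ∀ T, Monotone (τ T)
  first : ∀ T, τ T 0 = 0
  last : ∀ T, τ T (Fin.last (n + 1)) = T
  length_tendsto : ∀ i : Fin (n + 1),
    Tendsto (fun T => τ T i.succ - τ T i.castSucc) atTop atTop

/-- The regressors without breaks: the row of date `t` is `x_t'`. -/
def baseDesign {K : ℕ} (T : ℕ) (x : ℕ → Fin K → ℝ) : Matrix (Fin T) (Fin K) ℝ :=
  Matrix.of fun r k => x (r + 1) k

/-- The regressors of all the parameter changes: column `(j, k)` is `x_{t,k}` after the break
`j` and zero up to it. -/
def breakDesign {n K : ℕ} (T : ℕ) (τ : Fin (n + 2) → ℕ) (x : ℕ → Fin K → ℝ) :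
    Matrix (Fin T) (Fin n × Fin K) ℝ :=
  Matrix.of fun r jk => if τ jk.1.succ.castSucc < (r : ℕ) + 1 then x (r + 1) jk.2 else 0

/-- The full design matrix, with the changes of all the parameters at all the breaks. -/
def fullDesign {n K : ℕ} (T : ℕ) (τ : Fin (n + 2) → ℕ) (x : ℕ → Fin K → ℝ) :
    Matrix (Fin T) (Fin K ⊕ (Fin n × Fin K)) ℝ :=
  Matrix.fromCols (baseDesign T x) (breakDesign T τ x)

/-- The design matrix of the model whose set of active parameter changes is `B`. -/
def modelDesign {n K : ℕ} (T : ℕ) (τ : Fin (n + 2) → ℕ) (x : ℕ → Fin K → ℝ)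
    (B : Finset (Fin n × Fin K)) : Matrix (Fin T) (Fin K ⊕ {jk // jk ∈ B}) ℝ :=
  Matrix.fromCols (baseDesign T x) ((breakDesign T τ x).submatrix id Subtype.val)

/-- Residual sum of squares of the ordinary least squares regression of `y` on `X`: the least
value of `‖y - X b‖²` over all coefficient vectors `b`. -/
def rss {T : ℕ} {ι : Type*} [Fintype ι] (X : Matrix (Fin T) ι ℝ) (y : Fin T → ℝ) : ℝ :=
  ⨅ b : ι → ℝ, ∑ r, (y r - (X *ᵥ b) r) ^ 2

/-- The marginal likelihood criterion of the model with set of active parameter changes `B`,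
under the g-prior with parameter `g`. -/
def criterion {n K : ℕ} (g : ℝ) (T : ℕ) (τ : Fin (n + 2) → ℕ) (x : ℕ → Fin K → ℝ)
    (y : ℕ → ℝ) (B : Finset (Fin n × Fin K)) : ℝ :=
  (g / (1 + g)) ^ ((B.card : ℝ) / 2) *
    (g / (1 + g) * rss (baseDesign T x) (fun r => y (r + 1)) +
      1 / (1 + g) * rss (modelDesign T τ x B) (fun r => y (r + 1))) ^
        (-(((T : ℝ) - (K : ℝ)) / 2))

/-- The true set `A` of active parameter changes: the pairs `(j, k)` such that the coefficient of
the variable `k` changes at the break `j`; `β i` is the coefficient vector of the regime `i`. -/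
def trueSet {n K : ℕ} (β : Fin (n + 1) → Fin K → ℝ) : Finset (Fin n × Fin K) :=
  open Classical in
  Finset.univ.filter fun jk => β jk.1.succ jk.2 - β jk.1.castSucc jk.2 ≠ 0

section Probability

variable {Ω : Type*} [MeasurableSpace Ω]

/-- `y_t = x_t' β_i + ε_t` for all the dates `t` of the regime `i`, the first explanatory variable
being the constant `1`. The data form an array: the first index is the sample size. -/
structure IsBreakRegression {n K : ℕ} [NeZero K] (τ : ℕ → Fin (n + 2) → ℕ)
    (β : Fin (n + 1) → Fin K → ℝ) (x : ℕ → ℕ → Ω → Fin K → ℝ) (ε y : ℕ → ℕ → Ω → ℝ) : Prop where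
  measurable_x : ∀ T t, Measurable (x T t)
  measurable_ε : ∀ T t, Measurable (ε T t)
  intercept : ∀ T t ω, x T t ω 0 = 1
  model : ∀ T (i : Fin (n + 1)) t, τ T i.castSucc < t → t ≤ τ T i.succ → ∀ ω,
    y T t ω = ∑ k, x T t ω k * β i k + ε T t ω

/-- The eigenvalues of `T⁻¹ X' X`, with `X` the full design matrix, are bounded and bounded away
from zero, with probability tending to one. -/
def EigenvaluesBounded {n K : ℕ} (μ : Measure Ω) (τ : ℕ → Fin (n + 2) → ℕ)
    (x : ℕ → ℕ → Ω → Fin K → ℝ) : Prop :=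
  ∃ r₀ R₀ : ℝ, 0 < r₀ ∧ 0 < R₀ ∧
    Tendsto (fun T : ℕ => μ {ω |
        spectrum ℝ ((T : ℝ)⁻¹ • ((fullDesign T (τ T) fun t => x T t ω)ᵀ *
          fullDesign T (τ T) fun t => x T t ω)) ⊆ Set.Icc r₀ R₀})
      atTop (𝓝 1)

/-- Within each regime the process `(ε_t, x_t)` is a stretch of a stationary ergodic process:
there is a shift-invariant ergodic law on the space of sequences, not depending on `T`, such that
the segment has the law of the initial segment of the same length. -/
def RegimewiseErgodic {n K : ℕ} (μ : Measure Ω) (τ : ℕ → Fin (n + 2) → ℕ)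
    (x : ℕ → ℕ → Ω → Fin K → ℝ) (ε : ℕ → ℕ → Ω → ℝ) : Prop :=
  ∀ i : Fin (n + 1), ∃ ν : Measure (ℕ → ℝ × (Fin K → ℝ)), IsProbabilityMeasure ν ∧
    Ergodic (fun (z : ℕ → ℝ × (Fin K → ℝ)) (s : ℕ) => z (s + 1)) ν ∧
    ∀ T, μ.map (fun ω (s : Fin (τ T i.succ - τ T i.castSucc)) =>
        (ε T (τ T i.castSucc + 1 + s) ω, x T (τ T i.castSucc + 1 + s) ω)) =
      ν.map (fun z (s : Fin (τ T i.succ - τ T i.castSucc)) => z s)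

/-- The past before the date `t` of the process `(u_s)`, `s ≥ 1`. -/
abbrev past {E : Type*} [MeasurableSpace E] (u : ℕ → Ω → E) (t : ℕ) : MeasurableSpace Ω :=
  ⨆ s ∈ Finset.Ico 1 t, MeasurableSpace.comap (u s) inferInstance

/-- Exogeneity: `E(ε_t | x_t) = 0`, `E(ε_t²) = σ²`, and `x_t ε_t` is a martingale difference
sequence (with respect to its own past) with finite second moments. -/
structure IsExogenous {K : ℕ} (μ : Measure Ω) (σ : ℝ) (x : ℕ → ℕ → Ω → Fin K → ℝ)
    (ε : ℕ → ℕ → Ω → ℝ) : Prop where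
  condExp_error : ∀ T, ∀ t ∈ Finset.Icc 1 T,
    μ[ε T t | MeasurableSpace.comap (x T t) inferInstance] =ᵐ[μ] 0
  memLp_error : ∀ T, ∀ t ∈ Finset.Icc 1 T, MemLp (ε T t) 2 μ
  variance_error : ∀ T, ∀ t ∈ Finset.Icc 1 T, ∫ ω, ε T t ω ^ 2 ∂μ = σ ^ 2
  memLp_score : ∀ T, ∀ t ∈ Finset.Icc 1 T, ∀ k, MemLp (fun ω => x T t ω k * ε T t ω) 2 μ
  martingale_difference : ∀ T, ∀ t ∈ Finset.Icc 1 T, ∀ k,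
    μ[fun ω => x T t ω k * ε T t ω | past (fun s ω k' => x T s ω k' * ε T s ω) t] =ᵐ[μ] 0

end Probability

end BreakRegression

end

/-!
The criterion is, up to a factor common to all models, `(1 + w)^(-|B|/2)` times the power
`-(T - K)/2` of `s₀ / w + s_B`, where `s₀` and `s_B` are the residual sums of squares without breaks
and of the model `B`. The proof separates a deterministic comparison of these quantities for
"typical" samples (`IsTypical`) from the proof that samples are typical with probability close
to one.

*Typical samples.* Let `X` be the full design matrix, `e` the error vector, `θ` the true
coefficients. If `X'X ≥ r T`, `|X'e|² ≤ C T` and `c T ≤ e'e ≤ C T`, then for every `d`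
`|e + X d|² ≥ e'e + (r T / 2) |d|² - 2 C / r` (`IsTypical.le_sum_sq`). The coefficients of the
model `B` differ from `θ` by at least a fixed distance if `B` misses an active change, so that `s_B`
exceeds `s_A ≤ e'e` by an amount of order `T`; otherwise `s_B ≥ s_A - 2 C / r`. In the former case
the Bayes factor decays exponentially in `T`, against a penalty which is only `exp (o(T))` because
`w' / w → 0` (`tendsto_log_div_atTop_of_deriv_div`, `eventually_bayesFactor_lt_of_underfit`). In the
latter the likelihood part stays bounded and the penalty, at least `(1 + w)^(1/2)`, decides
(`eventually_bayesFactor_lt_of_overfit`). Hence `eventually_criterion_div_lt`.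

*Probability.* The bounds on `X'X` are the eigenvalue condition; they are stated through the
quadratic form because this gives a closed, hence measurable, condition. The bounds on `|X'e|²` and
on `e'e` from above are Markov's inequality: the scores are orthogonal, and by stationarity
their second moments take finitely many values. The lower bound on `e'e` is the mean ergodic theorem
of von Neumann, applied within each regime to the truncated squares `min (ε², 1)`
(`exists_tendsto_measure_sum_sq_lt`); truncation costs nothing since only some positive `c` is
needed. Together: `exists_eventually_measure_not_isTypical_le`.
-/

namespace BreakRegression

/-! ### Least squares -/

theorem rss_le {T : ℕ} {ι : Type*} [Fintype ι] (X : Matrix (Fin T) ι ℝ) (y : Fin T → ℝ)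
    (b : ι → ℝ) : rss X y ≤ ∑ r, (y r - (X *ᵥ b) r) ^ 2 :=
  ciInf_le ⟨0, Set.forall_mem_range.2 fun _ => Finset.sum_nonneg fun _ _ => sq_nonneg _⟩ b

theorem rss_nonneg {T : ℕ} {ι : Type*} [Fintype ι] (X : Matrix (Fin T) ι ℝ) (y : Fin T → ℝ) :
    0 ≤ rss X y :=
  le_ciInf fun _ => Finset.sum_nonneg fun _ _ => sq_nonneg _

/-- Bounds on the eigenvalues of a normalized Gram matrix, in terms of the quadratic form. -/
theorem quadraticForm_bounds_of_spectrum_subset {m ι : Type*} [Fintype m] [Fintype ι]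
    [DecidableEq ι] (X : Matrix m ι ℝ) {s r R : ℝ} (hs : 0 < s)
    (h : spectrum ℝ (s⁻¹ • (Xᵀ * X)) ⊆ Set.Icc r R) (v : ι → ℝ) :
    r * s * (v ⬝ᵥ v) ≤ (X *ᵥ v) ⬝ᵥ (X *ᵥ v) ∧ (X *ᵥ v) ⬝ᵥ (X *ᵥ v) ≤ R * s * (v ⬝ᵥ v) := by
  have hG : (s⁻¹ • (Xᵀ * X)).IsHermitian := by
    rw [Matrix.IsHermitian, Matrix.conjTranspose_eq_transpose_of_trivial]
    simp [Matrix.transpose_mul]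
  have hs1 : ∀ q : ℝ, (algebraMap ℝ (Matrix ι ι ℝ) q).IsHermitian := fun q => by
    rw [Matrix.IsHermitian, Matrix.conjTranspose_eq_transpose_of_trivial]
    simp [Matrix.algebraMap_eq_diagonal]
  have hform : v ⬝ᵥ ((s⁻¹ • (Xᵀ * X)) *ᵥ v) = s⁻¹ * ((X *ᵥ v) ⬝ᵥ (X *ᵥ v)) := by
    rw [Matrix.smul_mulVec, dotProduct_smul, smul_eq_mul, ← Matrix.mulVec_mulVec,
      Matrix.dotProduct_mulVec, Matrix.vecMul_transpose]
  have hscalar : ∀ q : ℝ, v ⬝ᵥ ((algebraMap ℝ (Matrix ι ι ℝ) q) *ᵥ v) = q * (v ⬝ᵥ v) := fun q => by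
    rw [Algebra.algebraMap_eq_smul_one, Matrix.smul_mulVec, Matrix.one_mulVec, dotProduct_smul,
      smul_eq_mul]
  constructor
  · have hp : (s⁻¹ • (Xᵀ * X) - algebraMap ℝ (Matrix ι ι ℝ) r).PosSemidef := by
      refine Matrix.posSemidef_iff_isHermitian_and_spectrum_nonneg.2 ⟨hG.sub (hs1 r), ?_⟩
      rw [← spectrum.sub_singleton_eq]
      rintro _ ⟨a, ha, b, rfl, rfl⟩
      exact sub_nonneg.2 (h ha).1
    have := hp.dotProduct_mulVec_nonneg v
    simp only [star_trivial, Matrix.sub_mulVec, dotProduct_sub, hform, hscalar] at this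
    have h2 := mul_le_mul_of_nonneg_left (sub_nonneg.1 this) hs.le
    rw [mul_inv_cancel_left₀ hs.ne'] at h2
    linarith
  · have hp : (algebraMap ℝ (Matrix ι ι ℝ) R - s⁻¹ • (Xᵀ * X)).PosSemidef := by
      refine Matrix.posSemidef_iff_isHermitian_and_spectrum_nonneg.2 ⟨(hs1 R).sub hG, ?_⟩
      rw [← spectrum.singleton_sub_eq]
      rintro _ ⟨a, rfl, b, hb, rfl⟩
      exact sub_nonneg.2 (h hb).2
    have := hp.dotProduct_mulVec_nonneg v
    simp only [star_trivial, Matrix.sub_mulVec, dotProduct_sub, hform, hscalar] at this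
    have h2 := mul_le_mul_of_nonneg_left (sub_nonneg.1 this) hs.le
    rw [mul_inv_cancel_left₀ hs.ne'] at h2
    linarith

/-- The deterministic content of "the sample is typical": a design matrix `X` and an error
vector `e` such that `X' X` is comparable to `T`, `e' e` is comparable to `T`, and the score
`X' e` has squared length at most of order `T`. -/
structure IsTypical {T : ℕ} {ι : Type*} [Fintype ι] (r R c C : ℝ) (X : Matrix (Fin T) ι ℝ)
    (e : Fin T → ℝ) : Prop where
  gram_lower : ∀ v, r * T * (v ⬝ᵥ v) ≤ (X *ᵥ v) ⬝ᵥ (X *ᵥ v)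
  gram_upper : ∀ v, (X *ᵥ v) ⬝ᵥ (X *ᵥ v) ≤ R * T * (v ⬝ᵥ v)
  error_lower : c * T ≤ e ⬝ᵥ e
  error_upper : e ⬝ᵥ e ≤ C * T
  score_upper : (e ᵥ* X) ⬝ᵥ (e ᵥ* X) ≤ C * T

/-- A deviation `d` from the true coefficients raises the residual sum of squares by at least
`r T |d|² / 2`, up to a bounded term. -/
theorem IsTypical.le_sum_sq {T : ℕ} {ι : Type*} [Fintype ι] {r R c C : ℝ}
    {X : Matrix (Fin T) ι ℝ} {e : Fin T → ℝ} (h : IsTypical r R c C X e) (hr : 0 < r)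
    (hT : 0 < T) (d : ι → ℝ) :
    e ⬝ᵥ e + r * T / 2 * (d ⬝ᵥ d) - 2 * C / r ≤ ∑ i, ((X *ᵥ d) i + e i) ^ 2 := by
  have hT' : (0 : ℝ) < T := by exact_mod_cast hT
  have hexp : ∑ i, ((X *ᵥ d) i + e i) ^ 2
      = (X *ᵥ d) ⬝ᵥ (X *ᵥ d) + 2 * ((e ᵥ* X) ⬝ᵥ d) + e ⬝ᵥ e := by
    rw [← Matrix.dotProduct_mulVec]
    simp only [dotProduct, Finset.mul_sum, ← Finset.sum_add_distrib]
    exact Finset.sum_congr rfl fun i _ => by ring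
  -- Young's inequality with weight `r T / 2`, which costs half of the quadratic form.
  have hyoung : -(r * T / 2 * (d ⬝ᵥ d) + 2 / (r * T) * ((e ᵥ* X) ⬝ᵥ (e ᵥ* X)))
      ≤ 2 * ((e ᵥ* X) ⬝ᵥ d) := by
    simp only [dotProduct, Finset.mul_sum, ← Finset.sum_add_distrib, ← Finset.sum_neg_distrib]
    refine Finset.sum_le_sum fun i _ => ?_
    have hpos : 0 < r * T := by positivity
    have : 0 ≤ 2 / (r * T) * ((e ᵥ* X) i + r * T / 2 * d i) ^ 2 := by positivity
    have heq : 2 / (r * T) * ((e ᵥ* X) i + r * T / 2 * d i) ^ 2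
        = 2 / (r * T) * ((e ᵥ* X) i * (e ᵥ* X) i) + 2 * ((e ᵥ* X) i * d i)
          + r * T / 2 * (d i * d i) := by
      field_simp
      ring
    linarith
  have hscore : 2 / (r * T) * ((e ᵥ* X) ⬝ᵥ (e ᵥ* X)) ≤ 2 * C / r := by
    calc 2 / (r * T) * ((e ᵥ* X) ⬝ᵥ (e ᵥ* X)) ≤ 2 / (r * T) * (C * T) :=
          mul_le_mul_of_nonneg_left h.score_upper (by positivity)
      _ = 2 * C / r := by field_simp
  have := h.gram_lower d
  linarith

/-! ### The regression model with all the breaks -/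

/-- Coefficients of the full design matrix obtained from those of the model `B`, with zero for
the parameter changes outside `B`. -/
def extendCoef {n K : ℕ} (B : Finset (Fin n × Fin K)) (b : Fin K ⊕ {jk // jk ∈ B} → ℝ) :
    Fin K ⊕ (Fin n × Fin K) → ℝ :=
  Sum.elim (fun k => b (Sum.inl k)) fun jk => if h : jk ∈ B then b (Sum.inr ⟨jk, h⟩) else 0

theorem modelDesign_mulVec {n K T : ℕ} (τ : Fin (n + 2) → ℕ) (x : ℕ → Fin K → ℝ)
    (B : Finset (Fin n × Fin K)) (b : Fin K ⊕ {jk // jk ∈ B} → ℝ) :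
    modelDesign T τ x B *ᵥ b = fullDesign T τ x *ᵥ extendCoef B b := by
  ext r
  simp only [modelDesign, fullDesign, Matrix.mulVec, dotProduct, Fintype.sum_sum_type,
    Matrix.fromCols_apply_inl, Matrix.fromCols_apply_inr, extendCoef, Sum.elim_inl, Sum.elim_inr,
    Matrix.submatrix_apply, id]
  congr 1
  rw [← Finset.sum_subset (Finset.subset_univ B) (fun jk _ h => by simp [h]),
    ← Finset.sum_coe_sort B]
  exact Finset.sum_congr rfl fun jk _ => by simp

/-- The true coefficients with respect to the full design matrix: the coefficients of the first
regime, and the parameter changes. -/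
def trueCoef {n K : ℕ} (β : Fin (n + 1) → Fin K → ℝ) : Fin K ⊕ (Fin n × Fin K) → ℝ :=
  Sum.elim (β 0) fun jk => β jk.1.succ jk.2 - β jk.1.castSucc jk.2

theorem mem_trueSet {n K : ℕ} {β : Fin (n + 1) → Fin K → ℝ} {jk : Fin n × Fin K} :
    jk ∈ trueSet β ↔ trueCoef β (Sum.inr jk) ≠ 0 := by
  simp [trueSet, trueCoef]

theorem extendCoef_trueSet {n K : ℕ} (β : Fin (n + 1) → Fin K → ℝ) :
    extendCoef (trueSet β) (fun i => trueCoef β (i.map id Subtype.val)) = trueCoef β := by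
  funext i
  rcases i with k | jk
  · rfl
  · by_cases h : jk ∈ trueSet β
    · simp [extendCoef, h]
    · have h0 : trueCoef β (Sum.inr jk) = 0 := by simpa [mem_trueSet] using h
      simp [extendCoef, h, h0]

/-- The changes at the breaks before the regime `i` sum up to the total change. -/
theorem sum_ite_change {n : ℕ} (b : Fin (n + 1) → ℝ) (i : Fin (n + 1)) :
    ∑ j : Fin n, (if j.succ ≤ i then b j.succ - b j.castSucc else 0) = b i - b 0 := by
  induction i using Fin.induction with
  | zero => simp
  | succ i ih =>
    have hsplit : ∀ j : Fin n, (if j.succ ≤ i.succ then b j.succ - b j.castSucc else 0)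
        = (if j.succ ≤ i.castSucc then b j.succ - b j.castSucc else 0)
          + if j = i then b j.succ - b j.castSucc else 0 := by
      intro j
      rcases lt_trichotomy j i with h | h | h
      · have h1 : j.succ ≤ i.castSucc := by
          simp only [Fin.le_def, Fin.val_succ, Fin.val_castSucc, Fin.lt_def] at h ⊢; omega
        have h2 : j.succ ≤ i.succ := Fin.succ_le_succ_iff.2 h.le
        rw [if_pos h2, if_pos h1, if_neg h.ne, add_zero]
      · subst h
        have h1 : ¬ j.succ ≤ j.castSucc := by simp [Fin.le_def]
        simp [h1]
      · have h1 : ¬ j.succ ≤ i.castSucc := by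
          simp only [Fin.le_def, Fin.val_succ, Fin.val_castSucc, Fin.lt_def] at h ⊢; omega
        have h2 : ¬ j.succ ≤ i.succ := by
          rw [Fin.succ_le_succ_iff]; exact not_le.2 h
        rw [if_neg h2, if_neg h1, if_neg h.ne', add_zero]
    rw [Finset.sum_congr rfl fun j _ => hsplit j, Finset.sum_add_distrib, ih]
    simp

/-- Every date of the sample belongs to a regime. -/
theorem IsBreakDates.exists_regime {n : ℕ} {τ : ℕ → Fin (n + 2) → ℕ} (hτ : IsBreakDates τ)
    {T t : ℕ} (h0 : 0 < t) (ht : t ≤ T) :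
    ∃ i : Fin (n + 1), τ T i.castSucc < t ∧ t ≤ τ T i.succ := by
  by_contra! H
  have : ∀ i : Fin (n + 2), τ T i < t := fun i => by
    induction i using Fin.induction with
    | zero => rw [hτ.first]; exact h0
    | succ i ih => exact H i ih
  have := this (Fin.last _)
  rw [hτ.last] at this
  omega

theorem fullDesign_mulVec_trueCoef {n K T : ℕ} {τ : Fin (n + 2) → ℕ} (hτ : Monotone τ)
    (x : ℕ → Fin K → ℝ) (β : Fin (n + 1) → Fin K → ℝ) (r : Fin T) (i : Fin (n + 1))
    (h1 : τ i.castSucc < (r : ℕ) + 1) (h2 : (r : ℕ) + 1 ≤ τ i.succ) :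
    (fullDesign T τ x *ᵥ trueCoef β) r = ∑ k, x (r + 1) k * β i k := by
  have hiff : ∀ j : Fin n, τ j.succ.castSucc < (r : ℕ) + 1 ↔ j.succ ≤ i := fun j => by
    constructor
    · intro h
      by_contra hji
      have : i.succ ≤ j.succ.castSucc := by
        simp only [Fin.le_def, Fin.val_succ, Fin.val_castSucc] at hji ⊢; omega
      have := hτ this
      omega
    · intro h
      exact (hτ (Fin.castSucc_le_castSucc_iff.2 h)).trans_lt h1
  simp only [fullDesign, Matrix.mulVec, dotProduct, Fintype.sum_sum_type,
    Matrix.fromCols_apply_inl, Matrix.fromCols_apply_inr, trueCoef, Sum.elim_inl, Sum.elim_inr,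
    baseDesign, breakDesign, Matrix.of_apply, hiff, Fintype.sum_prod_type]
  rw [Finset.sum_comm, ← Finset.sum_add_distrib]
  refine Finset.sum_congr rfl fun k _ => ?_
  have := sum_ite_change (fun i => β i k) i
  rw [show β i k = β 0 k + (β i k - β 0 k) by ring, ← this, mul_add, Finset.mul_sum]
  congr 1
  exact Finset.sum_congr rfl fun j _ => by split_ifs <;> simp

section ResidualBounds

variable {n K T : ℕ} {τ : Fin (n + 2) → ℕ} {x : ℕ → Fin K → ℝ} {β : Fin (n + 1) → Fin K → ℝ}
  {r R c C : ℝ} {y e : Fin T → ℝ}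

theorem rss_trueSet_le (hy : ∀ i, y i = (fullDesign T τ x *ᵥ trueCoef β) i + e i) :
    rss (modelDesign T τ x (trueSet β)) y ≤ e ⬝ᵥ e := by
  refine (rss_le _ _ fun i => trueCoef β (i.map id Subtype.val)).trans_eq ?_
  rw [modelDesign_mulVec, extendCoef_trueSet]
  exact Finset.sum_congr rfl fun i _ => by rw [hy]; ring

theorem rss_baseDesign_le (h : IsTypical r R c C (fullDesign T τ x) e)
    (hy : ∀ i, y i = (fullDesign T τ x *ᵥ trueCoef β) i + e i) :
    rss (baseDesign T x) y ≤ 2 * (C + R * (trueCoef β ⬝ᵥ trueCoef β)) * T := by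
  refine (rss_le _ _ 0).trans ?_
  calc ∑ i, (y i - (baseDesign T x *ᵥ 0) i) ^ 2
      ≤ ∑ i, 2 * ((fullDesign T τ x *ᵥ trueCoef β) i * (fullDesign T τ x *ᵥ trueCoef β) i
          + e i * e i) := by
        refine Finset.sum_le_sum fun i _ => ?_
        rw [Matrix.mulVec_zero, Pi.zero_apply, sub_zero, hy]
        nlinarith [sq_nonneg ((fullDesign T τ x *ᵥ trueCoef β) i - e i)]
    _ = 2 * ((fullDesign T τ x *ᵥ trueCoef β) ⬝ᵥ (fullDesign T τ x *ᵥ trueCoef β) + e ⬝ᵥ e) := by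
        simp only [dotProduct, ← Finset.mul_sum, ← Finset.sum_add_distrib]
    _ ≤ 2 * (C + R * (trueCoef β ⬝ᵥ trueCoef β)) * T := by
        linarith [h.gram_upper (trueCoef β), h.error_upper]

/-- Lower bound for the residual sum of squares of the model `B`, in terms of the squared
distance `q` of the true coefficients to those of the model. -/
theorem le_rss_modelDesign (h : IsTypical r R c C (fullDesign T τ x) e) (hr : 0 < r) (hT : 0 < T)
    (hy : ∀ i, y i = (fullDesign T τ x *ᵥ trueCoef β) i + e i) (B : Finset (Fin n × Fin K))
    {q : ℝ} (hq : ∀ b, q ≤ (trueCoef β - extendCoef B b) ⬝ᵥ (trueCoef β - extendCoef B b)) :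
    e ⬝ᵥ e + r * T / 2 * q - 2 * C / r ≤ rss (modelDesign T τ x B) y := by
  refine le_ciInf fun b => ?_
  have h1 := h.le_sum_sq hr hT (trueCoef β - extendCoef B b)
  have h2 : r * T / 2 * q
      ≤ r * T / 2 * ((trueCoef β - extendCoef B b) ⬝ᵥ (trueCoef β - extendCoef B b)) :=
    mul_le_mul_of_nonneg_left (hq b) (by positivity)
  have h3 : ∑ i, (y i - (modelDesign T τ x B *ᵥ b) i) ^ 2
      = ∑ i, ((fullDesign T τ x *ᵥ (trueCoef β - extendCoef B b)) i + e i) ^ 2 := by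
    refine Finset.sum_congr rfl fun i _ => ?_
    rw [modelDesign_mulVec, Matrix.mulVec_sub, Pi.sub_apply, hy]
    ring
  linarith

theorem le_dist_extendCoef {B : Finset (Fin n × Fin K)} {jk : Fin n × Fin K} (hB : jk ∉ B)
    (b : Fin K ⊕ {jk // jk ∈ B} → ℝ) :
    trueCoef β (Sum.inr jk) ^ 2
      ≤ (trueCoef β - extendCoef B b) ⬝ᵥ (trueCoef β - extendCoef B b) := by
  have h0 : extendCoef B b (Sum.inr jk) = 0 := by simp [extendCoef, hB]
  have := Finset.single_le_sum (f := fun i => (trueCoef β - extendCoef B b) i *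
    (trueCoef β - extendCoef B b) i) (fun i _ => mul_self_nonneg _)
    (Finset.mem_univ (Sum.inr jk))
  simpa only [dotProduct, Pi.sub_apply, h0, sub_zero, ← sq] using this

end ResidualBounds

/-! ### Asymptotics of the Bayes factor -/

/-- If `w' / w → 0`, then `w` grows subexponentially. -/
theorem tendsto_log_div_atTop_of_deriv_div {w : ℝ → ℝ}
    (hw_diff : ∀ᶠ t in atTop, DifferentiableAt ℝ w t) (hw_top : Tendsto w atTop atTop)
    (hw_deriv : Tendsto (fun t => deriv w t / w t) atTop (𝓝 0)) :
    Tendsto (fun t => Real.log (w t) / t) atTop (𝓝 0) := by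
  rw [Metric.tendsto_atTop]
  intro ε hε
  have h1 : ∀ᶠ t in atTop, ‖deriv w t / w t‖ ≤ ε / 2 := by
    have := (tendsto_zero_iff_norm_tendsto_zero.1 hw_deriv).eventually_lt_const (half_pos hε)
    exact this.mono fun _ h => h.le
  obtain ⟨a, ha⟩ := eventually_atTop.1
    ((hw_diff.and (hw_top.eventually_gt_atTop 0)).and h1)
  have hbound : ∀ t, a ≤ t → |Real.log (w t) - Real.log (w a)| ≤ ε / 2 * |t - a| := by
    intro t ht
    refine Convex.norm_image_sub_le_of_norm_hasDerivWithin_le (s := Set.Ici a)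
      (f := fun t => Real.log (w t)) (f' := fun t => deriv w t / w t) (fun s hs => ?_)
      (fun s hs => (ha s hs).2) (convex_Ici a) Set.self_mem_Ici ht
    exact ((ha s hs).1.1.hasDerivAt.log (ha s hs).1.2.ne').hasDerivWithinAt
  have hlim : Tendsto (fun t : ℝ => (|Real.log (w a)| + ε / 2 * |a|) / t) atTop (𝓝 0) :=
    tendsto_const_nhds.div_atTop tendsto_id
  obtain ⟨N, hN⟩ := eventually_atTop.1
    ((hlim.eventually_lt_const (half_pos hε)).and (eventually_gt_atTop (0 : ℝ)))
  refine ⟨max a N, fun t ht => ?_⟩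
  obtain ⟨hN1, ht0⟩ := hN t (le_of_max_le_right ht)
  rw [Real.dist_eq, sub_zero, abs_div, abs_of_pos ht0, div_lt_iff₀ ht0]
  rw [div_lt_iff₀ ht0] at hN1
  have h2 := hbound t (le_of_max_le_left ht)
  have h3 : |t - a| ≤ t + |a| := by
    have := abs_sub t a
    rwa [abs_of_pos ht0] at this
  have h4 : |Real.log (w t)| ≤ |Real.log (w t) - Real.log (w a)| + |Real.log (w a)| := by
    have := abs_add_le (Real.log (w t) - Real.log (w a)) (Real.log (w a))
    rwa [sub_add_cancel] at this
  nlinarith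

theorem bayesFactor_eq_exp {g a b : ℝ} (hg : 0 < g) (ha : 0 < a) (hb : 0 < b) (p q e : ℝ) :
    (g / (1 + g)) ^ (p / 2) * b ^ (-e) / ((g / (1 + g)) ^ (q / 2) * a ^ (-e))
      = Real.exp ((q - p) / 2 * Real.log (1 + 1 / g) - e * Real.log (b / a)) := by
  have hq : 0 < g / (1 + g) := by positivity
  have hlog : Real.log (1 + 1 / g) = -Real.log (g / (1 + g)) := by
    rw [← Real.log_inv]
    congr 1
    field_simp
    ring
  rw [Real.rpow_def_of_pos hq, Real.rpow_def_of_pos hq, Real.rpow_def_of_pos ha,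
    Real.rpow_def_of_pos hb, ← Real.exp_add, ← Real.exp_add, ← Real.exp_sub, hlog,
    Real.log_div hb.ne' ha.ne']
  congr 1
  ring

/-- A model whose residual sum of squares exceeds the true one by an amount of order `T` has a
Bayes factor that vanishes exponentially, whatever the subexponential penalty. -/
theorem eventually_bayesFactor_lt_of_underfit {v : ℕ → ℝ} (hv : Tendsto v atTop atTop)
    (hlog : Tendsto (fun T : ℕ => Real.log (1 + v T) / T) atTop (𝓝 0)) (K : ℕ) {p q κ M δ : ℝ}
    (hp : 0 ≤ p) (hκ : 0 < κ) (hM : 0 < M) (hδ : 0 < δ) :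
    ∀ᶠ T : ℕ in atTop, ∀ s s₀ s₁ : ℝ, 0 ≤ s₀ → 0 < s₁ → s₀ + s₁ ≤ M * T →
      s₁ + κ * T ≤ s →
      (1 / v T / (1 + 1 / v T)) ^ (p / 2) *
          (1 / v T / (1 + 1 / v T) * s₀ + 1 / (1 + 1 / v T) * s) ^ (-(((T : ℝ) - K) / 2)) /
        ((1 / v T / (1 + 1 / v T)) ^ (q / 2) *
          (1 / v T / (1 + 1 / v T) * s₀ + 1 / (1 + 1 / v T) * s₁) ^ (-(((T : ℝ) - K) / 2))) < δ := by
  have hl : 0 < Real.log (1 + κ / M) := Real.log_pos (by have := div_pos hκ hM; linarith)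
  -- the exponent, divided by `T`, has a negative limit
  have hlim : Tendsto (fun T : ℕ => (T : ℝ) * (|q| / 2 * (Real.log (1 + v T) / T)
      - (1 / 2 - K / 2 / T) * Real.log (1 + κ / M))) atTop atBot := by
    refine tendsto_natCast_atTop_atTop.atTop_mul_neg
      (C := |q| / 2 * 0 - (1 / 2 - 0) * Real.log (1 + κ / M)) (by linarith) ?_
    exact (hlog.const_mul _).sub
      ((tendsto_const_nhds.sub (tendsto_const_nhds.div_atTop
        tendsto_natCast_atTop_atTop)).mul_const _)
  filter_upwards [hlim.eventually_lt_atBot (Real.log δ), hv.eventually_ge_atTop 1,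
    eventually_gt_atTop K] with T hT hv1 hTK s s₀ s₁ hs₀ hs₁ hM' hs
  have hT0 : (0 : ℝ) < T := by exact_mod_cast (Nat.zero_le K).trans_lt hTK
  have hTK' : (0 : ℝ) ≤ ((T : ℝ) - K) / 2 := by
    have : (K : ℝ) < T := by exact_mod_cast hTK
    linarith
  set g := 1 / v T with hg
  have hg0 : 0 < g := by positivity
  have hg1 : g ≤ 1 := by rw [hg, div_le_one (by linarith)]; exact hv1
  have hvg : 1 + 1 / g = 1 + v T := by rw [hg, one_div_one_div]
  set a := g / (1 + g) * s₀ + 1 / (1 + g) * s₁ with ha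
  set b := g / (1 + g) * s₀ + 1 / (1 + g) * s with hb
  have ha0 : 0 < a := by positivity
  have hab : (1 + κ / M) * a ≤ b := by
    have h1 : a ≤ 1 / (1 + g) * (M * T) := by
      calc a = 1 / (1 + g) * (g * s₀ + s₁) := by rw [ha]; ring
        _ ≤ 1 / (1 + g) * (M * T) := by
          refine mul_le_mul_of_nonneg_left ?_ (by positivity)
          nlinarith
    have h2 : κ / M * a ≤ 1 / (1 + g) * (κ * T) := by
      calc κ / M * a ≤ κ / M * (1 / (1 + g) * (M * T)) :=
            mul_le_mul_of_nonneg_left h1 (by positivity)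
        _ = 1 / (1 + g) * (κ * T) := by field_simp
    have h3 : b = a + 1 / (1 + g) * (s - s₁) := by rw [ha, hb]; ring
    have h4 : 1 / (1 + g) * (κ * T) ≤ 1 / (1 + g) * (s - s₁) :=
      mul_le_mul_of_nonneg_left (by linarith) (by positivity)
    linarith
  have hκM : 0 < 1 + κ / M := by positivity
  have hb0 : 0 < b := (mul_pos hκM ha0).trans_le hab
  rw [bayesFactor_eq_exp hg0 ha0 hb0, hvg, ← Real.lt_log_iff_exp_lt hδ]
  refine lt_of_le_of_lt ?_ hT
  have h1 : Real.log (1 + κ / M) ≤ Real.log (b / a) :=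
    Real.log_le_log hκM ((le_div_iff₀ ha0).2 hab)
  have h2 : 0 ≤ Real.log (1 + v T) := Real.log_nonneg (by linarith)
  have h3 : (q - p) / 2 * Real.log (1 + v T) ≤ |q| / 2 * Real.log (1 + v T) :=
    mul_le_mul_of_nonneg_right (by linarith [le_abs_self q]) h2
  have h4 := mul_le_mul_of_nonneg_left h1 hTK'
  have h5 : (T : ℝ) * (|q| / 2 * (Real.log (1 + v T) / T)
      - (1 / 2 - K / 2 / T) * Real.log (1 + κ / M))
      = |q| / 2 * Real.log (1 + v T) - ((T : ℝ) - K) / 2 * Real.log (1 + κ / M) := by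
    field_simp
  linarith

/-- A model with superfluous parameters lowers the residual sum of squares by a bounded amount
only, which does not make up for the penalty `(1 + w)^(-1/2)` for each of them. -/
theorem eventually_bayesFactor_lt_of_overfit {v : ℕ → ℝ} (hv : Tendsto v atTop atTop) (K : ℕ)
    {p q c D δ : ℝ} (hpq : q + 1 ≤ p) (hc : 0 < c) (hD : 0 ≤ D) (hδ : 0 < δ) :
    ∀ᶠ T : ℕ in atTop, ∀ s s₀ s₁ : ℝ, 0 ≤ s₀ → 0 < s₁ → c * T ≤ s → s₁ ≤ s + D →
      (1 / v T / (1 + 1 / v T)) ^ (p / 2) *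
          (1 / v T / (1 + 1 / v T) * s₀ + 1 / (1 + 1 / v T) * s) ^ (-(((T : ℝ) - K) / 2)) /
        ((1 / v T / (1 + 1 / v T)) ^ (q / 2) *
          (1 / v T / (1 + 1 / v T) * s₀ + 1 / (1 + 1 / v T) * s₁) ^ (-(((T : ℝ) - K) / 2))) < δ := by
  have hlog : Tendsto (fun T => Real.log (1 + v T)) atTop atTop :=
    Real.tendsto_log_atTop.comp (tendsto_atTop_add_const_left _ 1 hv)
  filter_upwards [hlog.eventually_gt_atTop (2 * (D / c - Real.log δ)), hv.eventually_ge_atTop 1,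
    eventually_gt_atTop K] with T hT hv1 hTK s s₀ s₁ hs₀ hs₁ hs hs'
  have hT0 : (0 : ℝ) < T := by exact_mod_cast (Nat.zero_le K).trans_lt hTK
  have hTK' : (0 : ℝ) ≤ ((T : ℝ) - K) / 2 := by
    have : (K : ℝ) < T := by exact_mod_cast hTK
    linarith
  set g := 1 / v T with hg
  have hg0 : 0 < g := by positivity
  have hvg : 1 + 1 / g = 1 + v T := by rw [hg, one_div_one_div]
  have hs0 : 0 < s := (mul_pos hc hT0).trans_le hs
  set a := g / (1 + g) * s₀ + 1 / (1 + g) * s₁ with ha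
  set b := g / (1 + g) * s₀ + 1 / (1 + g) * s with hb
  have ha0 : 0 < a := by positivity
  have hb0 : 0 < b := by positivity
  have hab : a / b - 1 ≤ D / (c * T) := by
    rw [div_sub_one hb0.ne', div_le_div_iff₀ hb0 (by positivity)]
    have h1 : a - b = 1 / (1 + g) * (s₁ - s) := by rw [ha, hb]; ring
    have h2 : 1 / (1 + g) * (c * T) ≤ b := by
      have : 1 / (1 + g) * (c * T) ≤ 1 / (1 + g) * s :=
        mul_le_mul_of_nonneg_left hs (by positivity)
      have : 0 ≤ g / (1 + g) * s₀ := by positivity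
      linarith
    calc (a - b) * (c * T) = (s₁ - s) * (1 / (1 + g) * (c * T)) := by rw [h1]; ring
      _ ≤ D * (1 / (1 + g) * (c * T)) :=
          mul_le_mul_of_nonneg_right (by linarith) (by positivity)
      _ ≤ D * b := mul_le_mul_of_nonneg_left h2 hD
  rw [bayesFactor_eq_exp hg0 ha0 hb0, hvg, ← Real.lt_log_iff_exp_lt hδ]
  have h1 : -Real.log (b / a) ≤ D / (c * T) := by
    rw [← Real.log_inv, inv_div]
    exact (Real.log_le_sub_one_of_pos (by positivity)).trans hab
  have h2 : 0 ≤ Real.log (1 + v T) := Real.log_nonneg (by linarith)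
  have h3 : (q - p) / 2 * Real.log (1 + v T) ≤ (-1 / 2) * Real.log (1 + v T) :=
    mul_le_mul_of_nonneg_right (by linarith) h2
  have h4 := mul_le_mul_of_nonneg_left h1 hTK'
  have h5 : ((T : ℝ) - K) / 2 * (D / (c * T)) ≤ T * (D / (c * T)) := by
    refine mul_le_mul_of_nonneg_right ?_ (by positivity)
    have : (0 : ℝ) ≤ K := K.cast_nonneg
    linarith
  have h6 : T * (D / (c * T)) = D / c := by field_simp
  linarith

/-- For large samples that are typical, the criterion of every model other than the true one is
negligible with respect to that of the true one. -/
theorem eventually_criterion_div_lt {n K : ℕ} {τ : ℕ → Fin (n + 2) → ℕ}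
    (β : Fin (n + 1) → Fin K → ℝ) {w : ℝ → ℝ}
    (hw_diff : ∀ᶠ t in atTop, DifferentiableAt ℝ w t) (hw_top : Tendsto w atTop atTop)
    (hw_deriv : Tendsto (fun t => deriv w t / w t) atTop (𝓝 0)) {r R c C : ℝ} (hr : 0 < r)
    (hR : 0 < R) (hc : 0 < c) (hC : 0 < C) {B : Finset (Fin n × Fin K)} (hB : B ≠ trueSet β) {δ : ℝ}
    (hδ : 0 < δ) :
    ∀ᶠ T : ℕ in atTop, ∀ (x : ℕ → Fin K → ℝ) (y e : ℕ → ℝ),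
      (∀ i : Fin T, y (i + 1) = (fullDesign T (τ T) x *ᵥ trueCoef β) i + e (i + 1)) →
      IsTypical r R c C (fullDesign T (τ T) x) (fun i : Fin T => e (i + 1)) →
      0 < criterion (1 / w T) T (τ T) x y (trueSet β) ∧
      criterion (1 / w T) T (τ T) x y B / criterion (1 / w T) T (τ T) x y (trueSet β) < δ := by
  have hv : Tendsto (fun T : ℕ => w T) atTop atTop := hw_top.comp tendsto_natCast_atTop_atTop
  have hlog : Tendsto (fun T : ℕ => Real.log (1 + w T) / T) atTop (𝓝 0) := by
    have hle : ∀ᶠ T : ℕ in atTop, Real.log (1 + w T) / T ≤ Real.log 2 / T + Real.log (w T) / T := by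
      filter_upwards [hv.eventually_ge_atTop 1] with T hT
      rw [← add_div, ← Real.log_mul two_ne_zero (by linarith)]
      gcongr
      linarith
    have h1 : Tendsto (fun T : ℕ => Real.log 2 / T + Real.log (w T) / T) atTop (𝓝 0) := by
      have := (tendsto_const_nhds (x := Real.log 2)).div_atTop
        (tendsto_natCast_atTop_atTop (R := ℝ))
      simpa using this.add ((tendsto_log_div_atTop_of_deriv_div hw_diff hw_top hw_deriv).comp
        tendsto_natCast_atTop_atTop)
    refine tendsto_of_tendsto_of_tendsto_of_le_of_le' tendsto_const_nhds h1 ?_ hle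
    filter_upwards [hv.eventually_ge_atTop 1] with T hT
    exact div_nonneg (Real.log_nonneg (by linarith)) (Nat.cast_nonneg _)
  set D := 2 * C / r with hD
  have hD0 : 0 < D := by positivity
  set Q := trueCoef β ⬝ᵥ trueCoef β with hQ
  have hQ0 : 0 ≤ Q := Finset.sum_nonneg fun i _ => mul_self_nonneg _
  have hlarge : ∀ κ : ℝ, 0 < κ → ∀ᶠ T : ℕ in atTop, D ≤ κ * T := fun κ hκ =>
    (tendsto_natCast_atTop_atTop.const_mul_atTop hκ).eventually_ge_atTop D
  -- the bounds on the residual sums of squares which do not depend on `B`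
  have hcommon : ∀ᶠ T : ℕ in atTop, 0 < T ∧ 0 < w T ∧
      ∀ (x : ℕ → Fin K → ℝ) (y e : ℕ → ℝ),
      (∀ i : Fin T, y (i + 1) = (fullDesign T (τ T) x *ᵥ trueCoef β) i + e (i + 1)) →
      IsTypical r R c C (fullDesign T (τ T) x) (fun i : Fin T => e (i + 1)) →
      ∀ B, (fun i : Fin T => e (i + 1)) ⬝ᵥ (fun i : Fin T => e (i + 1)) - D
          ≤ rss (modelDesign T (τ T) x B) (fun r : Fin T => y (r + 1)) ∧
        c / 2 * T ≤ rss (modelDesign T (τ T) x B) (fun r : Fin T => y (r + 1)) := by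
    filter_upwards [hlarge (c / 2) (by positivity), eventually_gt_atTop 0,
      hv.eventually_gt_atTop 0] with T hT hT0 hw0
    refine ⟨hT0, hw0, fun x y e hy h B => ?_⟩
    have h1 := le_rss_modelDesign h hr hT0 (y := fun i : Fin T => y (i + 1)) hy B (q := 0)
      fun b => Finset.sum_nonneg fun i _ => mul_self_nonneg _
    have h2 := h.error_lower
    rw [mul_zero, add_zero] at h1
    exact ⟨h1, by linarith⟩
  have hpos : ∀ (T : ℕ) (x : ℕ → Fin K → ℝ) (y : ℕ → ℝ), 0 < w T →
      0 < rss (modelDesign T (τ T) x (trueSet β)) (fun r : Fin T => y (r + 1)) →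
      0 < criterion (1 / w T) T (τ T) x y (trueSet β) := by
    intro T x y hw0 h1
    have h0 := rss_nonneg (baseDesign T x) (fun r : Fin T => y (r + 1))
    have hg : 0 < 1 / w T := by positivity
    unfold criterion
    positivity
  by_cases hsub : trueSet β ⊆ B
  · -- superfluous parameters
    have hcard : ((trueSet β).card : ℝ) + 1 ≤ B.card := by
      exact_mod_cast Finset.card_lt_card (Finset.ssubset_iff_subset_ne.2 ⟨hsub, hB.symm⟩)
    filter_upwards [hcommon, eventually_bayesFactor_lt_of_overfit hv K hcard (half_pos hc) hD0.le hδ]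
      with T hT hover x y e hy h
    obtain ⟨hT0, hw0, hT⟩ := hT
    have hT0' : (0 : ℝ) < T := by exact_mod_cast hT0
    have hA := (mul_pos (half_pos hc) hT0').trans_le (hT x y e hy h (trueSet β)).2
    refine ⟨hpos T x y hw0 hA, hover _ _ _ (rss_nonneg _ _) hA (hT x y e hy h B).2 ?_⟩
    have h1 := rss_trueSet_le (y := fun i : Fin T => y (i + 1)) hy
    have h2 := (hT x y e hy h B).1
    linarith
  · -- an omitted parameter change
    obtain ⟨jk, hjkA, hjkB⟩ := Finset.not_subset.1 hsub
    have hq : 0 < trueCoef β (Sum.inr jk) ^ 2 := by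
      have := mem_trueSet.1 hjkA
      positivity
    set q := trueCoef β (Sum.inr jk) ^ 2
    have hM : 0 < 3 * C + 2 * R * Q := by positivity
    filter_upwards [hcommon, hlarge (r * q / 4) (by positivity),
      eventually_bayesFactor_lt_of_underfit hv hlog K (p := B.card) (q := (trueSet β).card)
        (κ := r * q / 4) (Nat.cast_nonneg _) (by positivity) hM hδ]
      with T hT hDT hunder x y e hy h
    obtain ⟨hT0, hw0, hT⟩ := hT
    have hT0' : (0 : ℝ) < T := by exact_mod_cast hT0
    have hA := (mul_pos (half_pos hc) hT0').trans_le (hT x y e hy h (trueSet β)).2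
    have h1 := rss_trueSet_le (y := fun i : Fin T => y (i + 1)) hy
    have h2 := rss_baseDesign_le (y := fun i : Fin T => y (i + 1)) h hy
    have h3 := le_rss_modelDesign h hr hT0 (y := fun i : Fin T => y (i + 1)) hy B
      (q := q) (le_dist_extendCoef hjkB)
    have h4 := h.error_upper
    refine ⟨hpos T x y hw0 hA, hunder _ _ _ (rss_nonneg _ _) hA ?_ ?_⟩
    · rw [← hQ] at h2
      linarith
    · linarith

/-! ### A law of large numbers for ergodic processes -/

/-- Mean ergodic theorem for a bounded observable of an ergodic transformation, as convergence
in probability of the time averages to the space average. -/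
theorem tendstoInMeasure_average_of_ergodic {S : Type*} [MeasurableSpace S] {ν : Measure S}
    [IsProbabilityMeasure ν] {f : S → S} (hf : Ergodic f ν) {φ : S → ℝ} (hφ : MemLp φ 2 ν) :
    TendstoInMeasure ν (fun (m : ℕ) z => (m : ℝ)⁻¹ * ∑ s ∈ Finset.range m, φ (f^[s] z)) atTop
      fun _ => ∫ z, φ z ∂ν := by
  have hmp := hf.toMeasurePreserving
  set U : Lp ℝ 2 ν →L[ℝ] Lp ℝ 2 ν :=
    (Lp.compMeasurePreservingₗᵢ ℝ f hmp).toContinuousLinearMap with hU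
  set F : Lp ℝ 2 ν := hφ.toLp φ with hF
  have hiter : ∀ s : ℕ, (U^[s] F : S → ℝ) =ᵐ[ν] fun z => φ (f^[s] z) := by
    intro s
    induction s with
    | zero => exact hφ.coeFn_toLp
    | succ s ih =>
      rw [Function.iterate_succ_apply']
      have h1 : (U (U^[s] F) : S → ℝ) =ᵐ[ν] (U^[s] F : S → ℝ) ∘ f :=
        Lp.coeFn_compMeasurePreserving _ hmp
      filter_upwards [h1, hmp.quasiMeasurePreserving.ae ih] with z hz1 hz2
      rw [hz1, Function.comp_apply, hz2, Function.iterate_succ_apply]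
  have hlim := U.tendsto_birkhoffAverage_orthogonalProjection
    (LinearIsometry.norm_toContinuousLinearMap_le _) F
  set P := (U.eqLocus (1 : Lp ℝ 2 ν →L[ℝ] Lp ℝ 2 ν)).orthogonalProjectionOnto F with hP
  -- the limit is invariant, hence constant, and the constant is the mean of `φ`
  have hfix : U (P : Lp ℝ 2 ν) = P := P.2
  obtain ⟨a, ha⟩ := hf.ae_eq_const_of_ae_eq_comp_ae (g := ((P : Lp ℝ 2 ν) : S → ℝ))
    (Lp.aestronglyMeasurable _) (by
      have h1 : (U (P : Lp ℝ 2 ν) : S → ℝ) =ᵐ[ν] ((P : Lp ℝ 2 ν) : S → ℝ) ∘ f :=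
        Lp.coeFn_compMeasurePreserving _ hmp
      rw [hfix] at h1
      exact h1.symm)
  have hone : MemLp (fun _ : S => (1 : ℝ)) 2 ν := memLp_const 1
  have hmean : ∫ z, φ z ∂ν = a := by
    have hinv : U (hone.toLp _) = hone.toLp _ := by
      refine Lp.ext ?_
      have h1 : (U (hone.toLp _) : S → ℝ) =ᵐ[ν] (hone.toLp _ : S → ℝ) ∘ f :=
        Lp.coeFn_compMeasurePreserving _ hmp
      filter_upwards [h1, hmp.quasiMeasurePreserving.ae hone.coeFn_toLp, hone.coeFn_toLp]
        with z hz1 hz2 hz3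
      rw [hz1, Function.comp_apply, hz2, hz3]
    have horth : inner ℝ (F - (P : Lp ℝ 2 ν)) (hone.toLp _) = 0 := (U.eqLocus (1 : Lp ℝ 2 ν →L[ℝ] Lp ℝ 2 ν)).starProjection_inner_eq_zero
      F (hone.toLp _) hinv
    rw [L2.inner_def] at horth
    have h2 : ∫ z, φ z - a ∂ν = 0 := by
      rw [← horth]
      refine integral_congr_ae ?_
      filter_upwards [Lp.coeFn_sub F (P : Lp ℝ 2 ν), ha, hφ.coeFn_toLp, hone.coeFn_toLp]
        with z h1 h2 h3 h4
      rw [h1, Pi.sub_apply, h2, h3, h4]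
      simp
    rw [integral_sub (hφ.integrable (by norm_num)) (integrable_const _)] at h2
    simp at h2
    linarith
  refine (tendstoInMeasure_of_tendsto_Lp hlim).congr (fun m => ?_) ?_
  · have hsum : ∀ m : ℕ, ((∑ s ∈ Finset.range m, U^[s] F : Lp ℝ 2 ν) : S → ℝ)
        =ᵐ[ν] fun z => ∑ s ∈ Finset.range m, φ (f^[s] z) := by
      intro m
      induction m with
      | zero => exact Lp.coeFn_zero ℝ 2 ν
      | succ m ih =>
        rw [Finset.sum_range_succ]
        filter_upwards [ih, hiter m, Lp.coeFn_add (∑ s ∈ Finset.range m, U^[s] F) (U^[m] F)]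
          with z h1 h2 h3
        rw [h3, Pi.add_apply, h1, h2, Finset.sum_range_succ]
    filter_upwards [hsum m, Lp.coeFn_smul ((m : ℝ)⁻¹) (∑ s ∈ Finset.range m, U^[s] F)] with z h1 h2
    rw [← h1, ← smul_eq_mul, ← Pi.smul_apply, ← h2]
    rfl
  · rw [hmean]
    exact ha

/-! ### Moments and laws -/

theorem integral_sum_sq_of_orthogonal {Ω ι : Type*} [MeasurableSpace Ω] {μ : Measure Ω}
    (s : Finset ι) (a : ι → ℝ) {u : ι → Ω → ℝ} (hu : ∀ i ∈ s, MemLp (u i) 2 μ)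
    (horth : ∀ i ∈ s, ∀ j ∈ s, i ≠ j → ∫ ω, u i ω * u j ω ∂μ = 0) :
    ∫ ω, (∑ i ∈ s, a i * u i ω) ^ 2 ∂μ = ∑ i ∈ s, a i ^ 2 * ∫ ω, u i ω ^ 2 ∂μ := by
  classical
  have hint : ∀ i ∈ s, ∀ j ∈ s, Integrable (fun ω => a i * u i ω * (a j * u j ω)) μ :=
    fun i hi j hj => ((hu i hi).const_mul (a i)).integrable_mul ((hu j hj).const_mul (a j))
  simp only [sq (∑ i ∈ s, a i * u i _), Finset.sum_mul_sum]
  rw [integral_finsetSum s fun i hi => integrable_finsetSum s fun j hj => hint i hi j hj]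
  refine Finset.sum_congr rfl fun i hi => ?_
  rw [integral_finsetSum s fun j hj => hint i hi j hj, Finset.sum_eq_single_of_mem i hi]
  · rw [← integral_const_mul]
    exact integral_congr_ae (.of_forall fun ω => by ring)
  · intro j hj hji
    rw [show (fun ω => a i * u i ω * (a j * u j ω)) = fun ω => a i * a j * (u i ω * u j ω) by
      funext ω; ring, integral_const_mul, horth i hi j hj hji.symm, mul_zero]

theorem integral_mul_eq_zero_of_condExp_eq_zero {Ω : Type*} {m m₀ : MeasurableSpace Ω}
    {μ : Measure Ω} [IsFiniteMeasure μ] (hm : m ≤ m₀) {f g : Ω → ℝ}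
    (hf : StronglyMeasurable[m] f) (hf2 : MemLp f 2 μ) (hg : MemLp g 2 μ)
    (h0 : μ[g | m] =ᵐ[μ] 0) : ∫ ω, f ω * g ω ∂μ = 0 := by
  have h1 := condExp_mul_of_stronglyMeasurable_left hf (hf2.integrable_mul hg)
    (hg.integrable (by norm_num))
  calc ∫ ω, f ω * g ω ∂μ = ∫ ω, (μ[f * g | m]) ω ∂μ := (integral_condExp hm).symm
    _ = ∫ _, (0 : ℝ) ∂μ := by
      refine integral_congr_ae ?_
      filter_upwards [h1, h0] with ω h1 h0
      rw [h1, Pi.mul_apply, h0, Pi.zero_apply, mul_zero]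
    _ = 0 := integral_zero _ _

section Probability

variable {Ω : Type*} [MeasurableSpace Ω] {μ : Measure Ω}

/-- Martingale differences are uncorrelated, hence the second moment of a weighted sum of scores
is the weighted sum of their second moments. -/
theorem IsExogenous.integral_sum_sq [IsFiniteMeasure μ] {K : ℕ} {σ : ℝ} {x : ℕ → ℕ → Ω → Fin K → ℝ}
    {ε : ℕ → ℕ → Ω → ℝ} (h : IsExogenous μ σ x ε) (hx : ∀ T t, Measurable (x T t))
    (hε : ∀ T t, Measurable (ε T t)) (T : ℕ) (k : Fin K) (a : Fin T → ℝ) :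
    ∫ ω, (∑ r : Fin T, a r * (x T (r + 1) ω k * ε T (r + 1) ω)) ^ 2 ∂μ
      = ∑ r : Fin T, a r ^ 2 * ∫ ω, (x T (r + 1) ω k * ε T (r + 1) ω) ^ 2 ∂μ := by
  have hmem : ∀ r : Fin T, (r : ℕ) + 1 ∈ Finset.Icc 1 T := fun r =>
    Finset.mem_Icc.2 ⟨by omega, r.2⟩
  have hpast : ∀ t, past (fun s ω k' => x T s ω k' * ε T s ω) t ≤ ‹MeasurableSpace Ω› := fun t =>
    iSup₂_le fun s _ => Measurable.comap_le <| measurable_pi_iff.2 fun k' =>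
      ((measurable_pi_apply k').comp (hx T s)).mul (hε T s)
  have hlt : ∀ r r' : Fin T, r < r' →
      ∫ ω, x T (r + 1) ω k * ε T (r + 1) ω * (x T (r' + 1) ω k * ε T (r' + 1) ω) ∂μ = 0 := by
    intro r r' hrr'
    refine integral_mul_eq_zero_of_condExp_eq_zero (hpast (r' + 1)) ?_
      (h.memLp_score T _ (hmem r) k) (h.memLp_score T _ (hmem r') k)
      (h.martingale_difference T _ (hmem r') k)
    have hle : MeasurableSpace.comap (fun ω k' => x T (r + 1) ω k' * ε T (r + 1) ω) inferInstance
        ≤ past (fun s ω k' => x T s ω k' * ε T s ω) (r' + 1) :=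
      le_iSup₂_of_le ((r : ℕ) + 1)
        (Finset.mem_Ico.2 ⟨by omega, by have := Fin.lt_def.1 hrr'; omega⟩) le_rfl
    have hmeas : Measurable[past (fun s ω k' => x T s ω k' * ε T s ω) (r' + 1)]
        (fun ω k' => x T (r + 1) ω k' * ε T (r + 1) ω) := Measurable.of_comap_le hle
    exact ((measurable_pi_apply k).comp hmeas).stronglyMeasurable
  refine integral_sum_sq_of_orthogonal Finset.univ a
    (fun r _ => h.memLp_score T _ (hmem r) k) fun r _ r' _ hne => ?_
  rcases lt_or_gt_of_ne hne with hr | hr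
  · exact hlt r r' hr
  · rw [← hlt r' r hr]
    exact integral_congr_ae (.of_forall fun ω => mul_comm _ _)

/-- Every date of a stationary stretch has the same law. -/
theorem map_eq_of_stretch {E : Type*} [MeasurableSpace E] {ν : Measure (ℕ → E)}
    (hν : MeasurePreserving (fun (z : ℕ → E) (s : ℕ) => z (s + 1)) ν ν) {m : ℕ}
    {u : ℕ → Ω → E} (hu : ∀ s, Measurable (u s))
    (hlaw : μ.map (fun ω (s : Fin m) => u s ω) = ν.map fun z (s : Fin m) => z s)
    {s : ℕ} (hs : s < m) : μ.map (u s) = ν.map fun z => z 0 := by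
  have h1 := congrArg (Measure.map fun z : Fin m → E => z ⟨s, hs⟩) hlaw
  have hseg : Measurable fun ω (s : Fin m) => u s ω := measurable_pi_iff.2 fun s => hu s
  have hrestr : Measurable fun (z : ℕ → E) (s : Fin m) => z s :=
    measurable_pi_iff.2 fun s => measurable_pi_apply _
  rw [Measure.map_map (measurable_pi_apply _) hseg,
    Measure.map_map (measurable_pi_apply _) hrestr] at h1
  have hiter : ∀ (s : ℕ) (z : ℕ → E), (fun (z : ℕ → E) (s : ℕ) => z (s + 1))^[s] z 0 = z s := by
    intro s
    induction s with
    | zero => exact fun z => rfl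
    | succ s ih => exact fun z => by rw [Function.iterate_succ_apply, ih]
  have h2 : ν.map (fun z : ℕ → E => z s) = ν.map fun z => z 0 := by
    conv_rhs => rw [← (hν.iterate s).map_eq]
    rw [Measure.map_map (measurable_pi_apply 0) (hν.iterate s).measurable]
    exact congrArg (Measure.map · ν) (funext fun z => (hiter s z).symm)
  exact h1.trans h2

/-- Stretches, of lengths tending to infinity, of an ergodic stationary process which is not
almost surely zero have sums of squares at least of the order of their lengths. Truncation makes
the squares bounded, so that the mean ergodic theorem applies without a fourth moment. -/
theorem exists_tendsto_measure_sum_sq_lt {E : Type*} [MeasurableSpace E] {ν : Measure (ℕ → E)}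
    [IsProbabilityMeasure ν] (hν : Ergodic (fun (z : ℕ → E) (s : ℕ) => z (s + 1)) ν)
    {ψ : E → ℝ} (hψ : Measurable ψ) (hne : ¬ ∀ᵐ z ∂ν, ψ (z 0) = 0) {m : ℕ → ℕ}
    (hm : Tendsto m atTop atTop) {u : ℕ → ℕ → Ω → E} (hu : ∀ T s, Measurable (u T s))
    (hlaw : ∀ T, μ.map (fun ω (s : Fin (m T)) => u T s ω) = ν.map fun z (s : Fin (m T)) => z s) :
    ∃ c > 0, Tendsto (fun T => μ {ω | ∑ s ∈ Finset.range (m T), ψ (u T s ω) ^ 2 < c * m T})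
      atTop (𝓝 0) := by
  set φ : (ℕ → E) → ℝ := fun z => min (ψ (z 0) ^ 2) 1 with hφ
  have hφm : Measurable φ := ((hψ.comp (measurable_pi_apply 0)).pow_const 2).min measurable_const
  have hφ0 : ∀ z, 0 ≤ φ z := fun z => le_min (sq_nonneg _) zero_le_one
  have hφ2 : MemLp φ 2 ν := MemLp.of_bound hφm.aestronglyMeasurable 1 <| .of_forall fun z => by
    rw [Real.norm_of_nonneg (hφ0 z)]
    exact min_le_right _ _
  have hpos : 0 < ∫ z, φ z ∂ν := by
    refine lt_of_le_of_ne (integral_nonneg hφ0) fun h0 => hne ?_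
    have := (integral_eq_zero_iff_of_nonneg hφ0 (hφ2.integrable (by norm_num))).1 h0.symm
    filter_upwards [this] with z hz
    by_contra hz0
    have : 0 < φ z := lt_min (by positivity) one_pos
    exact this.ne' hz
  have hiter : ∀ (s : ℕ) (z : ℕ → E),
      φ ((fun (z : ℕ → E) (s : ℕ) => z (s + 1))^[s] z) = min (ψ (z s) ^ 2) 1 := by
    intro s
    induction s with
    | zero => exact fun z => rfl
    | succ s ih => exact fun z => by rw [Function.iterate_succ_apply, ih]
  set I := ∫ z, φ z ∂ν with hI
  refine ⟨I / 2, half_pos hpos, ?_⟩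
  have hlim := tendstoInMeasure_iff_dist.1 (tendstoInMeasure_average_of_ergodic hν hφ2) (I / 2)
    (half_pos hpos)
  refine tendsto_of_tendsto_of_tendsto_of_le_of_le' tendsto_const_nhds (hlim.comp hm)
    (.of_forall fun _ => zero_le) ?_
  filter_upwards [hm.eventually_gt_atTop 0] with T hT
  have hT' : (0 : ℝ) < m T := by exact_mod_cast hT
  set V : Set (Fin (m T) → E) := {z | ∑ s, min (ψ (z s) ^ 2) 1 < I / 2 * m T} with hV
  have hVm : MeasurableSet V := by
    refine measurableSet_lt (Finset.measurable_sum _ fun s _ => ?_) measurable_const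
    exact ((hψ.comp (measurable_pi_apply s)).pow_const 2).min measurable_const
  calc μ {ω | ∑ s ∈ Finset.range (m T), ψ (u T s ω) ^ 2 < I / 2 * m T}
      ≤ μ ((fun ω (s : Fin (m T)) => u T s ω) ⁻¹' V) := by
        refine measure_mono fun ω hω => ?_
        simp only [Set.mem_ofPred_eq, Finset.sum_range] at hω
        exact (Finset.sum_le_sum fun s _ => min_le_left _ _).trans_lt hω
    _ = ν ((fun z (s : Fin (m T)) => z s) ⁻¹' V) := by
        have hseg : Measurable fun ω (s : Fin (m T)) => u T s ω :=
          measurable_pi_iff.2 fun s => hu T s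
        have hrestr : Measurable fun (z : ℕ → E) (s : Fin (m T)) => z s :=
          measurable_pi_iff.2 fun s => measurable_pi_apply _
        rw [← Measure.map_apply hseg hVm, hlaw, Measure.map_apply hrestr hVm]
    _ ≤ _ := by
        refine measure_mono fun z hz => ?_
        simp only [hV, Set.mem_preimage, Set.mem_ofPred_eq] at hz
        simp only [Set.mem_ofPred_eq, hiter, Finset.sum_range]
        rw [Real.dist_eq, abs_sub_comm]
        refine le_trans ?_ (le_abs_self _)
        have : (m T : ℝ)⁻¹ * ∑ s : Fin (m T), min (ψ (z s) ^ 2) 1 < I / 2 := by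
          rw [inv_mul_lt_iff₀ hT']
          linarith
        linarith

/-- Markov's inequality, at a level proportional to the bound on the mean. -/
theorem measure_not_le_mul_le [IsFiniteMeasure μ] {f : Ω → ℝ} (hf0 : ∀ ω, 0 ≤ f ω) (hf : Integrable f μ)
    {M C η s : ℝ} (hC : 0 < C) (hs : 0 < s) (hM : ∫ ω, f ω ∂μ ≤ M * s) (hMC : M ≤ η * C) :
    μ {ω | ¬ f ω ≤ C * s} ≤ ENNReal.ofReal η := by
  have h1 := mul_meas_ge_le_integral_of_nonneg (.of_forall hf0) hf (C * s)
  have hCs : 0 < C * s := by positivity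
  have h2 : μ.real {ω | C * s ≤ f ω} ≤ η := by
    refine le_of_mul_le_mul_left (h1.trans (hM.trans ?_)) hCs
    nlinarith
  calc μ {ω | ¬ f ω ≤ C * s} ≤ μ {ω | C * s ≤ f ω} :=
        measure_mono fun ω hω => (not_le.1 hω).le
    _ = ENNReal.ofReal (μ.real {ω | C * s ≤ f ω}) := (ofReal_measureReal (by simp)).symm
    _ ≤ ENNReal.ofReal η := ENNReal.ofReal_le_ofReal h2

/-! ### Typical samples have probability tending to one -/

/-- The set of matrices whose quadratic form satisfies given bounds is closed, which makes the
bounds a measurable event. -/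
theorem measurableSet_quadraticForm_bounds {n K : ℕ} (T : ℕ) (τ : Fin (n + 2) → ℕ)
    {x : ℕ → Ω → Fin K → ℝ} (hx : ∀ t, Measurable (x t)) (r R : ℝ) :
    MeasurableSet {ω | ∀ v, r * T * (v ⬝ᵥ v) ≤ (fullDesign T τ (fun t => x t ω) *ᵥ v) ⬝ᵥ
        (fullDesign T τ (fun t => x t ω) *ᵥ v) ∧
      (fullDesign T τ (fun t => x t ω) *ᵥ v) ⬝ᵥ (fullDesign T τ (fun t => x t ω) *ᵥ v)
        ≤ R * T * (v ⬝ᵥ v)} := by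
  have hmeas : Measurable fun ω (i : Fin T) (j : Fin K ⊕ (Fin n × Fin K)) =>
      fullDesign T τ (fun t => x t ω) i j := by
    refine measurable_pi_iff.2 fun i => measurable_pi_iff.2 fun j => ?_
    rcases j with k | jk
    · exact (measurable_pi_apply k).comp (hx _)
    · change Measurable fun ω => if τ jk.1.succ.castSucc < (i : ℕ) + 1 then x (i + 1) ω jk.2 else 0
      split_ifs
      · exact (measurable_pi_apply jk.2).comp (hx _)
      · exact measurable_const
  have hclosed : IsClosed {M : Fin T → Fin K ⊕ (Fin n × Fin K) → ℝ | ∀ v,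
      r * T * (v ⬝ᵥ v) ≤ (Matrix.of M *ᵥ v) ⬝ᵥ (Matrix.of M *ᵥ v) ∧
        (Matrix.of M *ᵥ v) ⬝ᵥ (Matrix.of M *ᵥ v) ≤ R * T * (v ⬝ᵥ v)} := by
    have hcont : ∀ v : Fin K ⊕ (Fin n × Fin K) → ℝ, Continuous
        fun M : Fin T → Fin K ⊕ (Fin n × Fin K) → ℝ =>
          (Matrix.of M *ᵥ v) ⬝ᵥ (Matrix.of M *ᵥ v) := fun v => by
      simp only [Matrix.mulVec, dotProduct, Matrix.of_apply]
      fun_prop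
    simp only [Set.ofPred_forall, Set.ofPred_and]
    exact isClosed_iInter fun v =>
      (isClosed_le continuous_const (hcont v)).inter (isClosed_le (hcont v) continuous_const)
  exact hmeas hclosed.measurableSet

theorem EigenvaluesBounded.exists_tendsto_measure_quadraticForm [IsProbabilityMeasure μ] {n K : ℕ}
    {τ : ℕ → Fin (n + 2) → ℕ} {x : ℕ → ℕ → Ω → Fin K → ℝ} (h : EigenvaluesBounded μ τ x)
    (hx : ∀ T t, Measurable (x T t)) :
    ∃ r > 0, ∃ R > 0, Tendsto (fun T : ℕ => μ {ω | ¬ ∀ v,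
        r * T * (v ⬝ᵥ v) ≤ (fullDesign T (τ T) (fun t => x T t ω) *ᵥ v) ⬝ᵥ
          (fullDesign T (τ T) (fun t => x T t ω) *ᵥ v) ∧
        (fullDesign T (τ T) (fun t => x T t ω) *ᵥ v) ⬝ᵥ
          (fullDesign T (τ T) (fun t => x T t ω) *ᵥ v) ≤ R * T * (v ⬝ᵥ v)}) atTop (𝓝 0) := by
  obtain ⟨r, R, hr, hR, hlim⟩ := h
  refine ⟨r, hr, R, hR, ?_⟩
  have h1 : Tendsto (fun T : ℕ => 1 - μ {ω |
      spectrum ℝ ((T : ℝ)⁻¹ • ((fullDesign T (τ T) fun t => x T t ω)ᵀ *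
        fullDesign T (τ T) fun t => x T t ω)) ⊆ Set.Icc r R}) atTop (𝓝 0) := by
    simpa using ENNReal.Tendsto.sub tendsto_const_nhds hlim (.inl ENNReal.one_ne_top)
  refine tendsto_of_tendsto_of_tendsto_of_le_of_le' tendsto_const_nhds h1
    (.of_forall fun _ => zero_le) ?_
  filter_upwards [eventually_gt_atTop 0] with T hT
  have hm := measurableSet_quadraticForm_bounds T (τ T) (hx T) r R
  refine (prob_compl_eq_one_sub hm).trans_le (tsub_le_tsub_left (measure_mono fun ω hω => ?_) _)
  exact quadraticForm_bounds_of_spectrum_subset _ (by exact_mod_cast hT) hω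

/-- The sum over a sample is the sum of the sums over the regimes. -/
theorem sum_regimes {n : ℕ} {τ : ℕ → Fin (n + 2) → ℕ} (hτ : IsBreakDates τ) (T : ℕ)
    (f : ℕ → ℝ) :
    ∑ r : Fin T, f (r + 1) = ∑ i : Fin (n + 1),
      ∑ s ∈ Finset.range (τ T i.succ - τ T i.castSucc), f (τ T i.castSucc + 1 + s) := by
  set G : ℕ → ℝ := fun m => ∑ s ∈ Finset.range m, f (s + 1) with hG
  have h1 : ∀ i : Fin (n + 1), ∑ s ∈ Finset.range (τ T i.succ - τ T i.castSucc),
      f (τ T i.castSucc + 1 + s) = G (τ T i.succ) - G (τ T i.castSucc) := fun i => by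
    rw [hG, ← Finset.sum_Ico_eq_sub _ (hτ.mono T i.castSucc_le_succ),
      Finset.sum_Ico_eq_sum_range]
    exact Finset.sum_congr rfl fun s _ => by rw [add_right_comm]
  have h2 := (Fin.sum_univ_succ fun i => G (τ T i)).symm.trans
    (Fin.sum_univ_castSucc fun i => G (τ T i))
  rw [hτ.first, hτ.last] at h2
  rw [Finset.sum_congr rfl fun i _ => h1 i, Finset.sum_sub_distrib]
  have h3 : G 0 = 0 := Finset.sum_range_zero _
  have h4 : G T = ∑ r : Fin T, f (r + 1) := Finset.sum_range _
  linarith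

section Errors

variable {n K : ℕ} {τ : ℕ → Fin (n + 2) → ℕ} {x : ℕ → ℕ → Ω → Fin K → ℝ} {ε : ℕ → ℕ → Ω → ℝ}
  {σ : ℝ}

/-- The second moments of the scores are bounded, because within each regime they are constant
and do not depend on the sample size. -/
theorem RegimewiseErgodic.exists_integral_score_sq_le (herg : RegimewiseErgodic μ τ x ε)
    (hτ : IsBreakDates τ) (hx : ∀ T t, Measurable (x T t)) (hε : ∀ T t, Measurable (ε T t)) :
    ∃ M > 0, ∀ T, ∀ t ∈ Finset.Icc 1 T, ∀ k, ∫ ω, (x T t ω k * ε T t ω) ^ 2 ∂μ ≤ M := by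
  choose ν _ hν hlaw using herg
  set m : Fin (n + 1) → Fin K → ℝ := fun i k => ∫ z, ((z 0).2 k * (z 0).1) ^ 2 ∂(ν i)
  have hm0 : ∀ i k, 0 ≤ m i k := fun i k => integral_nonneg fun _ => sq_nonneg _
  have hm : 0 ≤ ∑ i, ∑ k, m i k :=
    Finset.sum_nonneg fun i _ => Finset.sum_nonneg fun k _ => hm0 i k
  refine ⟨1 + ∑ i, ∑ k, m i k, by positivity, fun T t ht k => ?_⟩
  rw [Finset.mem_Icc] at ht
  obtain ⟨i, h1, h2⟩ := hτ.exists_regime (by omega : 0 < t) ht.2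
  have hmap := map_eq_of_stretch (hν i).toMeasurePreserving
    (u := fun s ω => (ε T (τ T i.castSucc + 1 + s) ω, x T (τ T i.castSucc + 1 + s) ω))
    (fun s => (hε T _).prodMk (hx T _)) (hlaw i T) (s := t - (τ T i.castSucc + 1)) (by omega)
  rw [show τ T i.castSucc + 1 + (t - (τ T i.castSucc + 1)) = t by omega] at hmap
  have hF : Measurable fun p : ℝ × (Fin K → ℝ) => (p.2 k * p.1) ^ 2 := by
    fun_prop
  have heq : ∫ ω, (x T t ω k * ε T t ω) ^ 2 ∂μ = m i k := by
    rw [← integral_map (φ := fun ω => (ε T t ω, x T t ω))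
      (f := fun p : ℝ × (Fin K → ℝ) => (p.2 k * p.1) ^ 2)
      ((hε T t).prodMk (hx T t)).aemeasurable hF.aestronglyMeasurable, hmap,
      integral_map (measurable_pi_apply 0).aemeasurable hF.aestronglyMeasurable]
  have h3 : m i k ≤ ∑ k, m i k := Finset.single_le_sum (fun k _ => hm0 i k) (Finset.mem_univ k)
  have h4 : ∑ k, m i k ≤ ∑ i, ∑ k, m i k :=
    Finset.single_le_sum (f := fun i => ∑ k, m i k)
      (fun i _ => Finset.sum_nonneg fun k _ => hm0 i k) (Finset.mem_univ i)
  linarith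

/-- The errors satisfy a one-sided law of large numbers. -/
theorem exists_tendsto_measure_error_lt (herg : RegimewiseErgodic μ τ x ε)
    (hτ : IsBreakDates τ) (hx : ∀ T t, Measurable (x T t)) (hε : ∀ T t, Measurable (ε T t))
    (hσ : 0 < σ) (hexo : IsExogenous μ σ x ε) :
    ∃ c > 0, Tendsto (fun T : ℕ => μ {ω | ¬ c * T ≤ ∑ r : Fin T, ε T (r + 1) ω * ε T (r + 1) ω})
      atTop (𝓝 0) := by
  have hregime : ∀ i : Fin (n + 1), ∃ c > 0, Tendsto (fun T => μ {ω |
      ∑ s ∈ Finset.range (τ T i.succ - τ T i.castSucc), ε T (τ T i.castSucc + 1 + s) ω ^ 2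
        < c * ((τ T i.succ - τ T i.castSucc : ℕ) : ℝ)}) atTop (𝓝 0) := by
    intro i
    obtain ⟨ν, _, hν, hlaw⟩ := herg i
    have hu : ∀ T s, Measurable fun ω =>
        (ε T (τ T i.castSucc + 1 + s) ω, x T (τ T i.castSucc + 1 + s) ω) :=
      fun T s => (hε T _).prodMk (hx T _)
    refine exists_tendsto_measure_sum_sq_lt hν (ψ := Prod.fst) measurable_fst ?_
      (m := fun T => τ T i.succ - τ T i.castSucc) (hτ.length_tendsto i)
      (u := fun T s ω => (ε T (τ T i.castSucc + 1 + s) ω, x T (τ T i.castSucc + 1 + s) ω)) hu hlaw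
    -- the errors of the regime have variance `σ²`, hence do not vanish
    intro h0
    obtain ⟨T, hT⟩ := ((hτ.length_tendsto i).eventually_gt_atTop 0).exists
    have hmap := map_eq_of_stretch hν.toMeasurePreserving (hu T) (hlaw T) hT
    have hle : τ T i.succ ≤ T := (hτ.mono T (Fin.le_last _)).trans_eq (hτ.last T)
    have hvar := hexo.variance_error T (τ T i.castSucc + 1 + 0) (Finset.mem_Icc.2 (by omega))
    have hF : Measurable fun p : ℝ × (Fin K → ℝ) => p.1 ^ 2 := measurable_fst.pow_const 2
    rw [← integral_map (φ := fun ω => (ε T (τ T i.castSucc + 1 + 0) ω,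
        x T (τ T i.castSucc + 1 + 0) ω)) (f := fun p : ℝ × (Fin K → ℝ) => p.1 ^ 2)
      (hu T 0).aemeasurable hF.aestronglyMeasurable, hmap,
      integral_map (measurable_pi_apply 0).aemeasurable hF.aestronglyMeasurable,
      integral_congr_ae (g := fun _ => (0 : ℝ)) (h0.mono fun z hz => by simp [hz]),
      integral_zero] at hvar
    exact (pow_pos hσ 2).ne hvar
  choose c hc hlim using hregime
  obtain ⟨i₀, hi₀⟩ := Finite.exists_min c
  refine ⟨c i₀, hc i₀, ?_⟩
  have hsum := tendsto_finsetSum Finset.univ fun i _ => hlim i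
  rw [Finset.sum_const_zero] at hsum
  refine tendsto_of_tendsto_of_tendsto_of_le_of_le tendsto_const_nhds hsum
    (fun _ => zero_le) fun T => ?_
  refine le_trans (measure_mono fun ω hω => ?_) (measure_iUnion_fintype_le μ _)
  by_contra hnot
  simp only [Set.mem_iUnion, Set.mem_ofPred_eq, not_exists, not_lt] at hnot
  refine hω ?_
  have h1 := sum_regimes hτ T fun t => ε T t ω ^ 2
  have h2 := sum_regimes hτ T fun _ => c i₀
  simp only [Finset.sum_const, Finset.card_univ, Fintype.card_fin, Finset.card_range,
    nsmul_eq_mul] at h2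
  simp only [← sq]
  rw [h1, mul_comm, h2]
  refine Finset.sum_le_sum fun i _ => le_trans ?_ (hnot i)
  rw [mul_comm]
  exact mul_le_mul_of_nonneg_right (hi₀ i) (Nat.cast_nonneg _)

theorem integrable_error_mul_self (hexo : IsExogenous μ σ x ε) (T : ℕ) (r : Fin T) :
    Integrable (fun ω => ε T (r + 1) ω * ε T (r + 1) ω) μ :=
  have h := hexo.memLp_error T (r + 1) (Finset.mem_Icc.2 ⟨by omega, r.2⟩)
  h.integrable_mul h

theorem integral_sum_error_sq (hexo : IsExogenous μ σ x ε) (T : ℕ) :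
    ∫ ω, ∑ r : Fin T, ε T (r + 1) ω * ε T (r + 1) ω ∂μ = σ ^ 2 * T := by
  have hmem : ∀ r : Fin T, (r : ℕ) + 1 ∈ Finset.Icc 1 T := fun r =>
    Finset.mem_Icc.2 ⟨by omega, r.2⟩
  rw [integral_finsetSum _ fun r _ => integrable_error_mul_self hexo T r]
  simp only [← sq, hexo.variance_error T _ (hmem _), Finset.sum_const, Finset.card_univ,
    Fintype.card_fin, nsmul_eq_mul]
  ring

/-- The variable that the column `j` of the full design matrix is made of. -/
def columnVariable {n K : ℕ} : Fin K ⊕ (Fin n × Fin K) → Fin K := Sum.elim id Prod.snd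

/-- The 0-1 pattern of the dates at which the column `j` of the full design matrix is active. -/
def columnPattern {n K : ℕ} (T : ℕ) (τ : Fin (n + 2) → ℕ) (j : Fin K ⊕ (Fin n × Fin K))
    (r : Fin T) : ℝ :=
  Sum.elim (fun _ => 1) (fun jk => if τ jk.1.succ.castSucc < (r : ℕ) + 1 then 1 else 0) j

theorem columnPattern_sq_le_one {n K : ℕ} (T : ℕ) (τ : Fin (n + 2) → ℕ)
    (j : Fin K ⊕ (Fin n × Fin K)) (r : Fin T) : columnPattern T τ j r ^ 2 ≤ 1 := by
  rcases j with k | jk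
  · simp [columnPattern]
  · simp only [columnPattern, Sum.elim_inr]
    split_ifs <;> simp

theorem vecMul_fullDesign_apply {n K T : ℕ} (τ : Fin (n + 2) → ℕ) (x : ℕ → Fin K → ℝ)
    (e : ℕ → ℝ) (j : Fin K ⊕ (Fin n × Fin K)) :
    ((fun r : Fin T => e (r + 1)) ᵥ* fullDesign T τ x) j
      = ∑ r : Fin T, columnPattern T τ j r * (x (r + 1) (columnVariable j) * e (r + 1)) := by
  simp only [Matrix.vecMul, dotProduct]
  refine Finset.sum_congr rfl fun r _ => ?_
  rcases j with k | jk
  · simp [fullDesign, baseDesign, columnPattern, columnVariable, mul_comm]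
  · simp only [fullDesign, Matrix.fromCols_apply_inr, breakDesign, Matrix.of_apply, columnPattern,
      columnVariable, Sum.elim_inr]
    split_ifs <;> simp [mul_comm]

theorem integrable_score_sq (hexo : IsExogenous μ σ x ε) (T : ℕ)
    (j : Fin K ⊕ (Fin n × Fin K)) :
    Integrable (fun ω => (∑ r : Fin T, columnPattern T (τ T) j r *
      (x T (r + 1) ω (columnVariable j) * ε T (r + 1) ω)) ^ 2) μ :=
  (memLp_finsetSum _ fun (r : Fin T) _ => (hexo.memLp_score T (r + 1)
    (Finset.mem_Icc.2 ⟨by omega, r.2⟩) (columnVariable j)).const_mul _).integrable_sq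

theorem integral_score_sq_le [IsFiniteMeasure μ] (hexo : IsExogenous μ σ x ε) (hx : ∀ T t, Measurable (x T t))
    (hε : ∀ T t, Measurable (ε T t)) {M : ℝ}
    (hM : ∀ T, ∀ t ∈ Finset.Icc 1 T, ∀ k, ∫ ω, (x T t ω k * ε T t ω) ^ 2 ∂μ ≤ M)
    (T : ℕ) (j : Fin K ⊕ (Fin n × Fin K)) :
    ∫ ω, (∑ r : Fin T, columnPattern T (τ T) j r *
      (x T (r + 1) ω (columnVariable j) * ε T (r + 1) ω)) ^ 2 ∂μ ≤ M * T := by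
  rw [hexo.integral_sum_sq hx hε]
  calc _ ≤ ∑ _r : Fin T, M := by
        refine Finset.sum_le_sum fun r _ => ?_
        refine le_trans (mul_le_of_le_one_left (integral_nonneg fun _ => sq_nonneg _)
          (columnPattern_sq_le_one T (τ T) j r)) (hM T _ (Finset.mem_Icc.2 ⟨by omega, r.2⟩) _)
    _ = M * T := by simp [mul_comm]

/-- Samples are typical with probability as close to one as desired. -/
theorem exists_eventually_measure_not_isTypical_le [IsProbabilityMeasure μ] (hτ : IsBreakDates τ)
    (heig : EigenvaluesBounded μ τ x) (herg : RegimewiseErgodic μ τ x ε)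
    (hx : ∀ T t, Measurable (x T t)) (hε : ∀ T t, Measurable (ε T t)) (hσ : 0 < σ)
    (hexo : IsExogenous μ σ x ε) {η : ℝ} (hη : 0 < η) :
    ∃ r > 0, ∃ R > 0, ∃ c > 0, ∃ C > 0, ∀ᶠ T : ℕ in atTop,
      μ {ω | ¬ IsTypical r R c C (fullDesign T (τ T) fun t => x T t ω)
        (fun i : Fin T => ε T (i + 1) ω)} ≤ ENNReal.ofReal η := by
  obtain ⟨r, hr, R, hR, hgram⟩ := heig.exists_tendsto_measure_quadraticForm hx
  obtain ⟨c, hc, herror⟩ := exists_tendsto_measure_error_lt herg hτ hx hε hσ hexo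
  obtain ⟨M, hM0, hM⟩ := herg.exists_integral_score_sq_le hτ hx hε
  set N : ℝ := ((Fintype.card (Fin K ⊕ (Fin n × Fin K)) : ℕ) : ℝ) with hN
  have hN0 : 0 ≤ N := Nat.cast_nonneg _
  set C := (σ ^ 2 + N * M) / (η / 4) with hC
  have hC0 : 0 < C := by positivity
  have hCη : η / 4 * C = σ ^ 2 + N * M := mul_div_cancel₀ _ (by positivity)
  refine ⟨r, hr, R, hR, c, hc, C, hC0, ?_⟩
  have hη4 : 0 < ENNReal.ofReal (η / 4) := ENNReal.ofReal_pos.2 (by positivity)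
  filter_upwards [hgram.eventually_le_const hη4, herror.eventually_le_const hη4,
    eventually_gt_atTop 0] with T hT1 hT2 hT0
  have hT0' : (0 : ℝ) < T := by exact_mod_cast hT0
  have hT3 := measure_not_le_mul_le (η := η / 4)
    (fun ω => Finset.sum_nonneg fun _ _ => mul_self_nonneg _)
    (integrable_finsetSum _ fun r _ => integrable_error_mul_self hexo T r) hC0 hT0' (integral_sum_error_sq hexo T).le
    (by rw [hCη]; nlinarith)
  have hT4 := measure_not_le_mul_le (μ := μ) (η := η / 4) (M := N * M)
    (f := fun ω => ∑ j : Fin K ⊕ (Fin n × Fin K), (∑ r : Fin T, columnPattern T (τ T) j r *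
      (x T (r + 1) ω (columnVariable j) * ε T (r + 1) ω)) ^ 2)
    (fun ω => Finset.sum_nonneg fun _ _ => sq_nonneg _)
    (integrable_finsetSum _ fun j _ => integrable_score_sq hexo T j) hC0 hT0' (by
      rw [integral_finsetSum _ fun j _ => integrable_score_sq hexo T j]
      calc _ ≤ ∑ _j : Fin K ⊕ (Fin n × Fin K), M * T :=
            Finset.sum_le_sum fun j _ => integral_score_sq_le hexo hx hε hM T j
        _ = N * M * T := by
            rw [Finset.sum_const, Finset.card_univ, nsmul_eq_mul, ← hN, mul_assoc])
    (by rw [hCη]; nlinarith)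
  have hsplit : ENNReal.ofReal η = ENNReal.ofReal (η / 4) + ENNReal.ofReal (η / 4)
      + ENNReal.ofReal (η / 4) + ENNReal.ofReal (η / 4) := by
    rw [← ENNReal.ofReal_add, ← ENNReal.ofReal_add, ← ENNReal.ofReal_add] <;> try positivity
    congr 1
    ring
  rw [hsplit]
  refine le_trans ?_ (add_le_add (add_le_add (add_le_add hT1 hT2) hT3) hT4)
  refine le_trans (measure_mono ?_) ((measure_union_le _ _).trans (add_le_add_left
    ((measure_union_le _ _).trans (add_le_add_left (measure_union_le _ _) _)) _))
  intro ω hω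
  by_contra hnot
  simp only [Set.mem_union, Set.mem_ofPred_eq, not_or, not_not] at hnot
  obtain ⟨⟨⟨h1, h2⟩, h3⟩, h4⟩ := hnot
  refine hω ⟨fun v => (h1 v).1, fun v => (h1 v).2, h2, h3, ?_⟩
  refine le_trans (Finset.sum_congr rfl fun j _ => ?_).le h4
  rw [vecMul_fullDesign_apply (τ T) (fun t => x T t ω) (fun t => ε T t ω) j, sq]

end Errors

end Probability

theorem IsBreakRegression.eq_fullDesign_mulVec_add {Ω : Type*} [MeasurableSpace Ω] {n K : ℕ} [NeZero K]
    {τ : ℕ → Fin (n + 2) → ℕ} (hτ : IsBreakDates τ) {β : Fin (n + 1) → Fin K → ℝ}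
    {x : ℕ → ℕ → Ω → Fin K → ℝ} {ε y : ℕ → ℕ → Ω → ℝ} (h : IsBreakRegression τ β x ε y)
    (T : ℕ) (ω : Ω) (r : Fin T) :
    y T (r + 1) ω = (fullDesign T (τ T) (fun t => x T t ω) *ᵥ trueCoef β) r + ε T (r + 1) ω := by
  obtain ⟨i, h1, h2⟩ := hτ.exists_regime (Nat.succ_pos r) (Nat.succ_le_of_lt r.2)
  rw [h.model T i _ h1 h2, fullDesign_mulVec_trueCoef (hτ.mono T) _ β r i h1 h2]

end BreakRegression

/-- With `g = 1 / w(T)`, the Bayes factor of every model against the true one tends to zero in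
probability, and with probability tending to one the true set of active parameter changes is the
unique maximizer of the criterion. -/
theorem proposition2 {Ω : Type*} [MeasurableSpace Ω] (μ : Measure Ω) [IsProbabilityMeasure μ]
    (n K : ℕ) [NeZero K]
    (τ : ℕ → Fin (n + 2) → ℕ) (hτ : BreakRegression.IsBreakDates τ)
    (β : Fin (n + 1) → Fin K → ℝ)
    (x : ℕ → ℕ → Ω → Fin K → ℝ) (ε y : ℕ → ℕ → Ω → ℝ)
    (hmodel : BreakRegression.IsBreakRegression τ β x ε y)
    (heig : BreakRegression.EigenvaluesBounded μ τ x)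
    (herg : BreakRegression.RegimewiseErgodic μ τ x ε)
    (σ : ℝ) (hσ : 0 < σ) (hexo : BreakRegression.IsExogenous μ σ x ε)
    (w : ℝ → ℝ) (hw_diff : ∀ᶠ t in atTop, DifferentiableAt ℝ w t)
    (hw_top : Tendsto w atTop atTop)
    (hw_deriv : Tendsto (fun t => deriv w t / w t) atTop (𝓝 0))
    (hw_ratio : ∃ L : ℝ, 0 ≤ L ∧ Tendsto (fun t => t / w t) atTop (𝓝 L)) :
    (∀ B : Finset (Fin n × Fin K), B ≠ BreakRegression.trueSet β →
      TendstoInMeasure μ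
        (fun (T : ℕ) ω =>
          BreakRegression.criterion (1 / w T) T (τ T) (fun t => x T t ω) (fun t => y T t ω) B /
            BreakRegression.criterion (1 / w T) T (τ T) (fun t => x T t ω) (fun t => y T t ω)
              (BreakRegression.trueSet β))
        atTop (fun _ => 0)) ∧
    Tendsto
      (fun T : ℕ => μ {ω | ∀ B : Finset (Fin n × Fin K), B ≠ BreakRegression.trueSet β →
        BreakRegression.criterion (1 / w T) T (τ T) (fun t => x T t ω) (fun t => y T t ω) B <
          BreakRegression.criterion (1 / w T) T (τ T) (fun t => x T t ω) (fun t => y T t ω)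
            (BreakRegression.trueSet β)})
      atTop (𝓝 1) := by
  have hy := BreakRegression.IsBreakRegression.eq_fullDesign_mulVec_add hτ hmodel
  have htyp := fun (η : ℝ) (hη : 0 < η) =>
    BreakRegression.exists_eventually_measure_not_isTypical_le hτ heig herg hmodel.measurable_x
      hmodel.measurable_ε hσ hexo hη
  -- an event that contains the atypical samples only, for large `T`, is negligible
  have hnegl : ∀ S : ℕ → Set Ω, (∀ r > 0, ∀ R > 0, ∀ c > 0, ∀ C > 0, ∀ᶠ T : ℕ in atTop,
      ∀ ω ∈ S T, ¬ BreakRegression.IsTypical r R c C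
        (BreakRegression.fullDesign T (τ T) fun t => x T t ω) (fun i : Fin T => ε T (i + 1) ω)) →
      Tendsto (fun T => μ (S T)) atTop (𝓝 0) := by
    intro S hS
    refine ENNReal.tendsto_nhds_zero.2 fun η hη => ?_
    obtain ⟨η', hη', hle⟩ : ∃ η' : ℝ, 0 < η' ∧ ENNReal.ofReal η' ≤ η := by
      rcases eq_or_ne η ⊤ with rfl | htop
      · exact ⟨1, one_pos, le_top⟩
      · exact ⟨η.toReal, ENNReal.toReal_pos hη.ne' htop, ENNReal.ofReal_toReal_le⟩
    obtain ⟨r, hr, R, hR, c, hc, C, hC, hT⟩ := htyp η' hη'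
    filter_upwards [hT, hS r hr R hR c hc C hC] with T h1 h2
    exact (measure_mono h2).trans (h1.trans hle)
  constructor
  · intro B hB
    refine tendstoInMeasure_iff_dist.2 fun δ hδ => hnegl _ fun r hr R hR c hc C hC => ?_
    filter_upwards [BreakRegression.eventually_criterion_div_lt (τ := τ) β hw_diff hw_top hw_deriv
      hr hR hc hC hB hδ, hw_top.comp tendsto_natCast_atTop_atTop |>.eventually_gt_atTop 0]
      with T hT hw0 ω hω htypical
    obtain ⟨hA, hlt⟩ := hT _ (fun t => y T t ω) (fun t => ε T t ω) (hy T ω) htypical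
    have hpos : 0 ≤ BreakRegression.criterion (1 / w T) T (τ T) (fun t => x T t ω)
        (fun t => y T t ω) B := by
      have h0 := BreakRegression.rss_nonneg (BreakRegression.baseDesign T fun t => x T t ω)
        (fun r : Fin T => y T (r + 1) ω)
      have h1 := BreakRegression.rss_nonneg
        (BreakRegression.modelDesign T (τ T) (fun t => x T t ω) B)
        (fun r : Fin T => y T (r + 1) ω)
      have hg : 0 < 1 / w T := one_div_pos.2 hw0
      unfold BreakRegression.criterion
      positivity
    rw [Real.dist_eq, sub_zero, abs_of_nonneg (div_nonneg hpos hA.le)] at hω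
    exact absurd hlt (not_lt.2 hω)
  · set S : ℕ → Set Ω := fun T => {ω | ∀ B : Finset (Fin n × Fin K),
      B ≠ BreakRegression.trueSet β →
      BreakRegression.criterion (1 / w T) T (τ T) (fun t => x T t ω) (fun t => y T t ω) B <
        BreakRegression.criterion (1 / w T) T (τ T) (fun t => x T t ω) (fun t => y T t ω)
          (BreakRegression.trueSet β)} with hS
    have hcompl : Tendsto (fun T => μ (S T)ᶜ) atTop (𝓝 0) := by
      refine hnegl _ fun r hr R hR c hc C hC => ?_
      have hall : ∀ᶠ T : ℕ in atTop, ∀ B : Finset (Fin n × Fin K),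
          B ≠ BreakRegression.trueSet β → ∀ (x : ℕ → Fin K → ℝ) (y e : ℕ → ℝ), _ :=
        eventually_all.2 fun B => eventually_imp_distrib_left.2 fun hB =>
          BreakRegression.eventually_criterion_div_lt (τ := τ) β hw_diff hw_top hw_deriv
            hr hR hc hC hB one_pos
      filter_upwards [hall] with T hT ω hω htypical
      refine hω fun B hB => ?_
      obtain ⟨hA, hlt⟩ := hT B hB _ (fun t => y T t ω) (fun t => ε T t ω) (hy T ω) htypical
      exact (div_lt_one hA).1 hlt
    have hlow : Tendsto (fun T => 1 - μ (S T)ᶜ) atTop (𝓝 1) := by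
      simpa using ENNReal.Tendsto.sub tendsto_const_nhds hcompl (.inl ENNReal.one_ne_top)
    -- subadditivity gives the lower bound without measurability of the event
    refine tendsto_of_tendsto_of_tendsto_of_le_of_le hlow tendsto_const_nhds (fun T => ?_)
      fun T => prob_le_one
    rw [tsub_le_iff_right, ← measure_univ (μ := μ), ← Set.union_compl_self (S T)]
    exact measure_union_le _ _
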